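/- **Conventions.** A $\mathbf{Cpo}$-category is a category whose hom-sets are $\omega$-complete partial orders (no bottom required) such that composition $\mathcal C(Y,Z)\times\mathcal C(X,Y)\to\mathcal C(X,Z)$ is $\omega$-continuous; a $\mathbf{Cpo}$-functor is a functor that is $\omega$-continuous on hom-sets. Duals and products of $\mathbf{Cpo}$-categories carry the evident orders. $[\mathcal D,\mathcal C]$ is the $\mathbf{Cpo}$-category of $\mathbf{Cpo}$-functors and natural transformations ordered pointwise, and $\mathrm{Endo}(\mathcal C)=[\mathcal C,\mathcal C]$. $\mathcal D$ is *$\mathbf{Cpo}$-algebraically compact* if every $\mathbf{Cpo}$-endofunctor of $\mathcal D$ has an initial algebra and a final coalgebra, and the canonical algebra morphism from the initial algebra to the inverse of the final coalgebra is an isomorphism. Fix a choice of final coalgebras $\nu H:|\nu H|\to H|\nu H|$ for $H\in\mathrm{Endo}(\mathcal D)$; for $\alpha:H\to K$ let $|\nu\alpha|:|\nu H|\to|\nu K|$ be the induced coalgebra morphism. Let $R:\mathcal D\to\mathcal C$ be a $\mathbf{Cpo}$-functor. * $R$ is *2-monic* if for all $\mathbf{Cpo}$-functors $g,h:\mathcal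 E\to\mathcal D$ every natural isomorphism $R\circ g\cong R\circ h$ is of the form $R\beta$ for a natural isomorphism $\beta:g\cong h$. * Let $\mathcal P$ be the pseudo-pullback of $R\circ-:\mathrm{Endo}(\mathcal D)\to[\mathcal D,\mathcal C]$ and $-\circ R:\mathrm{Endo}(\mathcal C)\to[\mathcal D,\mathcal C]$: its objects are triples $(H,G,\varphi)$ with $\varphi:R\circ H\cong G\circ R$, its morphisms $(H,G,\varphi)\to(H',G',\varphi')$ are pairs $h:H\to H'$, $g:G\to G'$ with $\varphi'\circ Rh=gR\circ\varphi$. * $\mathrm{Lift}(R)$ is the replete image of $\mathcal P\to\mathrm{Endo}(\mathcal C)$: its objects are the $G$ with $R\circ H\cong G\circ R$ for some $H$; its morphisms are the $g:G\to G'$ such that $(h,g)$ is a morphism of $\mathcal P$ for some $h$ and some $\varphi,\varphi'$; and $g\le g'$ in $\mathrm{Lift}(R)$ iff $g\le g'$ in $\mathrm{Endo}(\mathcal C)$ and, for some common $\varphi,\varphi'$, there are $h\le h'$ such that $(h,g)$ and $(h',g')$ are morphisms of $\mathcal P$. For $R$ 2-monic this is a $\mathbf{Cpo}$-category. * *Final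 invariants lift along $R$* if every $G\in\mathrm{Lift}(R)$ has a final coalgebra and the functors $(H,G,\varphi)\mapsto R|\nu H|$ and $(H,G,\varphi)\mapsto|\nu G|$ from $\mathcal P$ to $\mathcal C$ are naturally isomorphic. For a $\mathbf{Cpo}$-functor $F:\mathcal D^{op}\times\mathcal D\to\mathrm{Lift}(R)$ consider the system $$G\cong F(|\nu H|,|\nu H|),\qquad R\circ H\cong G\circ R. \tag{$*$}$$ A *solution* consists of $S=(H,G,\varphi)\in\mathcal P$ and an isomorphism $\gamma:F(|\nu H|,|\nu H|)\cong G$. A *morphism* from a solution $(S,\gamma)$ to a solution $(S',\gamma')$ is a pair of morphisms $e:S\to S'$, $p:S'\to S$ of $\mathcal P$ with $$e\circ\gamma=\gamma'\circ F(|\nu p|,|\nu e|),\qquad p\circ\gamma'=\gamma\circ F(|\nu e|,|\nu p|)$$ (where $|\nu e|:|\nu H|\to|\nu H'|$ and $|\nu p|:|\nu H'|\to|\nu H|$ come from the $\mathrm{Endo}(\mathcal D)$-components, and $e,p$ in the equations denote the $\mathrm{Endo}(\mathcal C)$-components). Equivalently, $(p,e)$ is a morphism of algebras from the invariant $(S,S)$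 to the invariant $(S',S')$ of the symmetric endofunctor $(Y,X)\mapsto\big(F(|\nu X|,|\nu Y|),\,F(|\nu Y|,|\nu X|)\big)$ on $\mathrm{Lift}(R)^{op}\times\mathrm{Lift}(R)$ (objects being presented with a lifting in $\mathcal P$). $S$ *dominates* $S'$ if there is such a morphism with $p\circ e=\mathrm{id}_S$, i.e. the identity of the invariant $(S,S)$ factors through $(S',S')$. A solution is *dominating* if it dominates every solution. **Theorem.** Let $\mathcal D$ be $\mathbf{Cpo}$-algebraically compact, let $R:\mathcal D\to\mathcal C$ be a 2-monic $\mathbf{Cpo}$-functor along which final invariants lift, and let $F:\mathcal D^{op}\times\mathcal D\to\mathrm{Lift}(R)$ be a $\mathbf{Cpo}$-functor. Then $(*)$ has a dominating solution $S$, and it is unique up to isomorphism: for every dominating solution $S'$ there is a morphism $(e,p)$ from $S$ to $S'$ with $e$ and $p$ mutually inverse. The invariant $(S,S)$ is moreover an initial algebra (hence, by the symmetry exchanging the two components, its inverse is a final coalgebra) of the symmetric endofunctor above. If in addition $\mathcal D$ is enriched over pointed cpos (every hom-set has a least element and a composite of least elements is least), then for every solution $S'$ and every morphism $(e,p)$ from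 $S$ to $S'$, the pair $(e,p)$ is a coreflection: $p\circ e=\mathrm{id}_S$, and $e\circ p\le\mathrm{id}_{S'}$ both in $\mathrm{Endo}(\mathcal D)$ and in $\mathrm{Endo}(\mathcal C)$. -/

import Mathlib

open CategoryTheory OmegaCompletePartialOrder

universe v u v₁ u₁ v₂ u₂ v₃ u₃

/-! ### Continuity for `ω`-complete partial orders -/

theorem cont_of_le {α β : Type*} [OmegaCompletePartialOrder α] [OmegaCompletePartialOrder β]
    {f : α → β} (hf : Monotone f)
    (h : ∀ (c : Chain α) (y : β), (∀ i, f (c i) ≤ y) → f (ωSup c) ≤ y) : ωScottContinuous f := by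
  refine ωScottContinuous.of_monotone_map_ωSup ⟨hf, fun c => le_antisymm ?_ ?_⟩
  · exact h c _ fun i => le_ωSup (c.map ⟨f, hf⟩) i
  · exact ωSup_le _ _ fun i => hf (le_ωSup c i)

theorem le_of_cont {α β : Type*} [OmegaCompletePartialOrder α] [OmegaCompletePartialOrder β]
    {f : α → β} (hf : ωScottContinuous f) (c : Chain α) (y : β) (h : ∀ i, f (c i) ≤ y) :
    f (ωSup c) ≤ y := by
  rw [hf.map_ωSup]
  exact ωSup_le _ _ h

/-- The constant chain. -/
def constChain {α : Type*} [Preorder α] (a : α) : Chain α := ⟨⟨fun _ => a, fun _ _ _ => le_rfl⟩⟩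

theorem ωSup_constChain {α : Type*} [OmegaCompletePartialOrder α] (a : α) :
    ωSup (constChain a) = a :=
  le_antisymm (ωSup_le _ _ fun _ => le_rfl) (le_ωSup (constChain a) 0)

/-! ### `Cpo`-categories and `Cpo`-functors -/

/-- A `Cpo`-enriched category: every hom-set carries an `ω`-complete partial order (no bottom
element is required) and composition is a continuous operation on the product. -/
class CpoCategory (C : Type u) [Category.{v} C] where
  homOrder : ∀ X Y : C, OmegaCompletePartialOrder (X ⟶ Y)
  comp_cont : ∀ X Y Z : C,
    ωScottContinuous (fun p : (X ⟶ Y) × (Y ⟶ Z) => p.1 ≫ p.2)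

instance CpoCategory.instHom {C : Type u} [Category.{v} C] [CpoCategory C] (X Y : C) :
    OmegaCompletePartialOrder (X ⟶ Y) := CpoCategory.homOrder X Y

section CpoCategory

variable {C : Type u} [Category.{v} C] [CpoCategory C]

theorem cpo_comp_mono {X Y Z : C} {f f' : X ⟶ Y} {g g' : Y ⟶ Z} (hf : f ≤ f') (hg : g ≤ g') :
    f ≫ g ≤ f' ≫ g' :=
  (CpoCategory.comp_cont X Y Z).monotone (show (f, g) ≤ (f', g') from ⟨hf, hg⟩)

theorem cpo_comp_sup {X Y Z : C} (c : Chain (X ⟶ Y)) (d : Chain (Y ⟶ Z)) (y : X ⟶ Z)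
    (h : ∀ i, c i ≫ d i ≤ y) : ωSup c ≫ ωSup d ≤ y :=
  le_of_cont (CpoCategory.comp_cont X Y Z) (c.zip d) y h

theorem cpo_comp_eq {X Y Z : C} (c : Chain (X ⟶ Y)) (d : Chain (Y ⟶ Z)) (e : Chain (X ⟶ Z))
    (h : ∀ i, c i ≫ d i = e i) : ωSup c ≫ ωSup d = ωSup e := by
  apply le_antisymm
  · exact cpo_comp_sup c d _ fun i => (h i).le.trans (le_ωSup e i)
  · exact ωSup_le _ _ fun i =>
      (h i).ge.trans (cpo_comp_mono (le_ωSup c i) (le_ωSup d i))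

end CpoCategory

/-- Build a `Cpo`-category from orders on the hom-sets for which composition is monotone and
commutes with suprema of chains. -/
abbrev CpoCategory.ofOrder {E : Type u} [Category.{v} E]
    (ord : ∀ X Y : E, OmegaCompletePartialOrder (X ⟶ Y))
    (hmono : ∀ {X Y Z : E} (f f' : X ⟶ Y) (g g' : Y ⟶ Z), f ≤ f' → g ≤ g' → f ≫ g ≤ f' ≫ g')
    (hsup : ∀ {X Y Z : E} (c : Chain (X ⟶ Y)) (d : Chain (Y ⟶ Z)) (y : X ⟶ Z),
      (∀ i, c i ≫ d i ≤ y) → ωSup c ≫ ωSup d ≤ y) : CpoCategory E where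
  homOrder := ord
  comp_cont _ _ _ := cont_of_le (fun _ _ h => hmono _ _ _ _ h.1 h.2)
    (fun c y h => hsup (c.map OrderHom.fst) (c.map OrderHom.snd) y h)

section Op

variable {C : Type u} [Category.{v} C] [CpoCategory C]

abbrev opHomPartialOrder (X Y : Cᵒᵖ) : PartialOrder (X ⟶ Y) where
  le f g := f.unop ≤ g.unop
  le_refl f := le_refl f.unop
  le_trans _ _ _ a b := le_trans (α := Y.unop ⟶ X.unop) a b
  le_antisymm _ _ a b := Quiver.Hom.unop_inj (le_antisymm (α := Y.unop ⟶ X.unop) a b)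

def unopChain {X Y : Cᵒᵖ} (c : @Chain (X ⟶ Y) (opHomPartialOrder X Y).toPreorder) :
    Chain (Y.unop ⟶ X.unop) :=
  letI := opHomPartialOrder X Y
  ⟨⟨fun n => (c n).unop, fun _ _ h => c.monotone h⟩⟩

abbrev opHomOrder (X Y : Cᵒᵖ) : OmegaCompletePartialOrder (X ⟶ Y) :=
  { opHomPartialOrder X Y with
    ωSup := fun c => (ωSup (unopChain c)).op
    le_ωSup := fun c i => le_ωSup (unopChain c) i
    ωSup_le := fun c x h => ωSup_le (unopChain c) x.unop h }

attribute [local instance] opHomOrder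

/-- The dual `Cpo`-category: `Cᵒᵖ(X, Y) = C(Y, X)` with the same order. -/
instance CpoCategory.instOp : CpoCategory Cᵒᵖ :=
  CpoCategory.ofOrder opHomOrder (fun _ _ _ _ hf hg => cpo_comp_mono (C := C) hg hf)
    (fun c d y h => cpo_comp_sup (C := C) (unopChain d) (unopChain c) y.unop h)

end Op

section Product

variable {C : Type u₁} [Category.{v₁} C] [CpoCategory C]
  {D : Type u₂} [Category.{v₂} D] [CpoCategory D]

abbrev prodHomOrder (X Y : C × D) : OmegaCompletePartialOrder (X ⟶ Y) :=
  inferInstanceAs (OmegaCompletePartialOrder ((X.1 ⟶ Y.1) × (X.2 ⟶ Y.2)))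

attribute [local instance] prodHomOrder

def fstChain {X Y : C × D} (c : Chain (X ⟶ Y)) : Chain (X.1 ⟶ Y.1) :=
  ⟨⟨fun n => (c n).1, fun _ _ h => (c.monotone h).1⟩⟩

def sndChain {X Y : C × D} (c : Chain (X ⟶ Y)) : Chain (X.2 ⟶ Y.2) :=
  ⟨⟨fun n => (c n).2, fun _ _ h => (c.monotone h).2⟩⟩

/-- The product of `Cpo`-categories, with the product order on hom-sets. -/
instance CpoCategory.instProd : CpoCategory (C × D) :=
  CpoCategory.ofOrder prodHomOrder
    (fun _ _ _ _ hf hg => ⟨cpo_comp_mono hf.1 hg.1, cpo_comp_mono hf.2 hg.2⟩)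
    (fun c d y h => ⟨
      cpo_comp_sup (fstChain c) (fstChain d) y.1 fun i => (h i).1,
      cpo_comp_sup (sndChain c) (sndChain d) y.2 fun i => (h i).2⟩)

end Product

/-- A `Cpo`-functor: a functor acting continuously on hom-sets. -/
structure CpoFunctor (C : Type u₁) [Category.{v₁} C] [CpoCategory C]
    (D : Type u₂) [Category.{v₂} D] [CpoCategory D] extends C ⥤ D where
  map_cont : ∀ X Y : C, ωScottContinuous (fun f : X ⟶ Y => toFunctor.map f)

section FunctorCategory

variable {C : Type u₁} [Category.{v₁} C] [CpoCategory C]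
  {D : Type u₂} [Category.{v₂} D] [CpoCategory D]
  {E : Type u₃} [Category.{v₃} E] [CpoCategory E]

/-- The morphisms of the functor category `[C, D]` are all natural transformations. -/
instance : Category (CpoFunctor C D) where
  Hom F G := F.toFunctor ⟶ G.toFunctor
  id F := 𝟙 F.toFunctor
  comp α β := NatTrans.vcomp α β

/-- The component at `X` of a morphism of `[C, D]`. -/
abbrev CpoFunctor.app {F G : CpoFunctor C D} (α : F ⟶ G) (X : C) : F.obj X ⟶ G.obj X :=
  NatTrans.app α X

theorem CpoFunctor.hom_ext {F G : CpoFunctor C D} {α β : F ⟶ G}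
    (h : ∀ X, CpoFunctor.app α X = CpoFunctor.app β X) : α = β :=
  NatTrans.ext (funext h)

theorem CpoFunctor.naturality {F G : CpoFunctor C D} (α : F ⟶ G) {X Y : C} (f : X ⟶ Y) :
    F.map f ≫ CpoFunctor.app α Y = CpoFunctor.app α X ≫ G.map f :=
  NatTrans.naturality (F := F.toFunctor) (G := G.toFunctor) α f

@[simp] theorem CpoFunctor.id_app (F : CpoFunctor C D) (X : C) :
    CpoFunctor.app (𝟙 F) X = 𝟙 (F.obj X) := rfl

@[simp] theorem CpoFunctor.comp_app {F G H : CpoFunctor C D} (α : F ⟶ G) (β : G ⟶ H) (X : C) :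
    CpoFunctor.app (α ≫ β) X = CpoFunctor.app α X ≫ CpoFunctor.app β X := rfl

/-- Natural transformations are ordered pointwise. -/
abbrev natPartialOrder (F G : CpoFunctor C D) : PartialOrder (F ⟶ G) where
  le α β := ∀ X, CpoFunctor.app α X ≤ CpoFunctor.app β X
  le_refl _ _ := le_rfl
  le_trans _ _ _ a b X := (a X).trans (b X)
  le_antisymm _ _ a b := CpoFunctor.hom_ext fun X => (a X).antisymm (b X)

def appChain {F G : CpoFunctor C D} (c : @Chain (F ⟶ G) (natPartialOrder F G).toPreorder)
    (X : C) : Chain (F.obj X ⟶ G.obj X) :=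
  letI := natPartialOrder F G
  ⟨⟨fun n => CpoFunctor.app (c n) X, fun _ _ h => c.monotone h X⟩⟩

/-- Suprema of chains of natural transformations are computed pointwise. -/
abbrev natOrder (F G : CpoFunctor C D) : OmegaCompletePartialOrder (F ⟶ G) :=
  letI po := natPartialOrder F G
  { po with
    ωSup := fun c =>
      { app := fun X => ωSup (appChain c X)
        naturality := fun X Y f => by
          have h1 := cpo_comp_eq (constChain (F.map f)) (appChain c Y)
            ((appChain c Y).map ⟨fun g => F.map f ≫ g, fun _ _ h => cpo_comp_mono le_rfl h⟩)
            (fun _ => rfl)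
          have h2 := cpo_comp_eq (appChain c X) (constChain (G.map f))
            ((appChain c Y).map ⟨fun g => F.map f ≫ g, fun _ _ h => cpo_comp_mono le_rfl h⟩)
            (fun i => (CpoFunctor.naturality (c i) f).symm)
          rw [ωSup_constChain] at h1 h2
          exact h1.trans h2.symm }
    le_ωSup := fun c i X => le_ωSup (appChain c X) i
    ωSup_le := fun c x h X => ωSup_le (appChain c X) _ fun i => h i X }

/-- The `Cpo`-category `[C, D]` of `Cpo`-functors and natural transformations. -/
instance : CpoCategory (CpoFunctor C D) :=
  CpoCategory.ofOrder natOrder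
    (fun _ _ _ _ hf hg X => cpo_comp_mono (hf X) (hg X))
    (fun c d _ h X => cpo_comp_sup (appChain c X) (appChain d X) _ fun i => h i X)

/-- Composition `G ∘ F` of `Cpo`-functors. -/
def CpoFunctor.comp (F : CpoFunctor C D) (G : CpoFunctor D E) : CpoFunctor C E where
  toFunctor := F.toFunctor ⋙ G.toFunctor
  map_cont X Y := (G.map_cont _ _).comp (F.map_cont X Y)

/-- `R h : R ∘ H ⟶ R ∘ H'` for `h : H ⟶ H'`. -/
def CpoFunctor.whiskerRight {H H' : CpoFunctor C D} (h : H ⟶ H') (R : CpoFunctor D E) :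
    H.comp R ⟶ H'.comp R :=
  Functor.whiskerRight (G := H.toFunctor) (H := H'.toFunctor) h R.toFunctor

/-- `g R : G ∘ R ⟶ G' ∘ R` for `g : G ⟶ G'`. -/
def CpoFunctor.whiskerLeft (R : CpoFunctor C D) {G G' : CpoFunctor D E} (g : G ⟶ G') :
    R.comp G ⟶ R.comp G' :=
  Functor.whiskerLeft R.toFunctor (G := G.toFunctor) (H := G'.toFunctor) g

@[simp] theorem CpoFunctor.whiskerRight_app {H H' : CpoFunctor C D} (h : H ⟶ H')
    (R : CpoFunctor D E) (X : C) :
    CpoFunctor.app (CpoFunctor.whiskerRight h R) X = R.map (CpoFunctor.app h X) := rfl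

@[simp] theorem CpoFunctor.whiskerLeft_app (R : CpoFunctor C D) {G G' : CpoFunctor D E}
    (g : G ⟶ G') (X : C) :
    CpoFunctor.app (CpoFunctor.whiskerLeft R g) X = CpoFunctor.app g (R.obj X) := rfl

@[simp] theorem CpoFunctor.whiskerRight_id (H : CpoFunctor C D) (R : CpoFunctor D E) :
    CpoFunctor.whiskerRight (𝟙 H) R = 𝟙 (H.comp R) :=
  CpoFunctor.hom_ext fun X => R.map_id (H.obj X)

@[simp] theorem CpoFunctor.whiskerRight_comp {H H' H'' : CpoFunctor C D} (h : H ⟶ H')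
    (k : H' ⟶ H'') (R : CpoFunctor D E) :
    CpoFunctor.whiskerRight (h ≫ k) R
      = CpoFunctor.whiskerRight h R ≫ CpoFunctor.whiskerRight k R :=
  CpoFunctor.hom_ext fun X => R.map_comp (CpoFunctor.app h X) (CpoFunctor.app k X)

@[simp] theorem CpoFunctor.whiskerLeft_id (R : CpoFunctor C D) (G : CpoFunctor D E) :
    CpoFunctor.whiskerLeft R (𝟙 G) = 𝟙 (R.comp G) := rfl

@[simp] theorem CpoFunctor.whiskerLeft_comp (R : CpoFunctor C D) {G G' G'' : CpoFunctor D E}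
    (g : G ⟶ G') (k : G' ⟶ G'') :
    CpoFunctor.whiskerLeft R (g ≫ k)
      = CpoFunctor.whiskerLeft R g ≫ CpoFunctor.whiskerLeft R k := rfl

end FunctorCategory

/-- A `Cpo`-category is enriched over pointed cpos when each hom-set has a least element and
composition is strict. -/
def IsCpoBotEnriched (C : Type u) [Category.{v} C] [CpoCategory C] : Prop :=
  (∀ X Y : C, ∃ b : X ⟶ Y, IsBot b) ∧
    ∀ (X Y Z : C) (b : X ⟶ Y) (b' : Y ⟶ Z), IsBot b → IsBot b' → IsBot (b ≫ b')

/-! ### Final coalgebras and algebraic compactness -/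

/-- `Cpo`-algebraic compactness: every `Cpo`-endofunctor has an initial algebra and a final
coalgebra, and these are canonically isomorphic, i.e. the (unique) morphism of algebras from the
initial algebra to the inverse of the final coalgebra is invertible. -/
def CpoAlgebraicallyCompact (D : Type u) [Category.{v} D] [CpoCategory D] : Prop :=
  ∀ H : CpoFunctor D D, ∃ (A : Endofunctor.Algebra H.toFunctor)
    (Z : Endofunctor.Coalgebra H.toFunctor),
    Nonempty (Limits.IsInitial A) ∧ Nonempty (Limits.IsTerminal Z) ∧
      ∃ i : A.a ≅ Z.V, A.str ≫ i.hom ≫ Z.str = H.map i.hom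

/-- A final coalgebra `νH : |νH| ⟶ H |νH|`. -/
structure FinalCoalgebra {C : Type u} [Category.{v} C] [CpoCategory C] (H : CpoFunctor C C) where
  coalg : Endofunctor.Coalgebra H.toFunctor
  final : Limits.IsTerminal coalg

namespace FinalCoalgebra

variable {C : Type u} [Category.{v} C] [CpoCategory C] {G H K : CpoFunctor C C}

/-- The carrier `|νH|`. -/
abbrev carrier (ν : FinalCoalgebra H) : C := ν.coalg.V

/-- For `α : H ⟶ K`, the morphism `|να| : |νH| ⟶ |νK|` is the coinductive extension of the
`K`-coalgebra `α ∘ νH` on `|νH|`. -/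
def map (νH : FinalCoalgebra H) (νK : FinalCoalgebra K) (α : H ⟶ K) : νH.carrier ⟶ νK.carrier :=
  (νK.final.from ⟨νH.coalg.V, νH.coalg.str ≫ CpoFunctor.app α νH.coalg.V⟩).f

theorem map_spec (νH : FinalCoalgebra H) (νK : FinalCoalgebra K) (α : H ⟶ K) :
    (νH.coalg.str ≫ CpoFunctor.app α νH.coalg.V) ≫ K.map (map νH νK α)
      = map νH νK α ≫ νK.coalg.str :=
  (νK.final.from ⟨νH.coalg.V, νH.coalg.str ≫ CpoFunctor.app α νH.coalg.V⟩).h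

theorem map_unique (νH : FinalCoalgebra H) (νK : FinalCoalgebra K) (α : H ⟶ K)
    (x : νH.carrier ⟶ νK.carrier)
    (hx : (νH.coalg.str ≫ CpoFunctor.app α νH.coalg.V) ≫ K.map x = x ≫ νK.coalg.str) :
    x = map νH νK α :=
  congrArg Endofunctor.Coalgebra.Hom.f (νK.final.hom_ext
    (⟨x, hx⟩ : (⟨νH.coalg.V, νH.coalg.str ≫ CpoFunctor.app α νH.coalg.V⟩ :
      Endofunctor.Coalgebra K.toFunctor) ⟶ νK.coalg) _)

theorem map_id (νH : FinalCoalgebra H) : map νH νH (𝟙 H) = 𝟙 νH.carrier :=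
  (map_unique νH νH (𝟙 H) (𝟙 _) (by
    rw [H.map_id, CpoFunctor.id_app]; simp)).symm

theorem map_comp (νG : FinalCoalgebra G) (νH : FinalCoalgebra H) (νK : FinalCoalgebra K)
    (α : G ⟶ H) (β : H ⟶ K) : map νG νK (α ≫ β) = map νG νH α ≫ map νH νK β :=
  (map_unique νG νK (α ≫ β) _ (by
    have h1 := map_spec νG νH α
    have h2 := map_spec νH νK β
    have h3 := CpoFunctor.naturality β (map νG νH α)
    rw [CpoFunctor.comp_app, K.map_comp]
    simp only [Category.assoc] at h1 h2 h3 ⊢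
    rw [← h2, reassoc_of% h1.symm, reassoc_of% h3])).symm

end FinalCoalgebra

/-- `|ν-|` along a functor `K` into `Endo(C)` for a chosen family of final coalgebras. -/
def nuFunctor {C : Type u₁} [Category.{v₁} C] [CpoCategory C] {I : Type u₂} [Category.{v₂} I]
    (K : I ⥤ CpoFunctor C C) (ν : ∀ i, FinalCoalgebra (K.obj i)) : I ⥤ C where
  obj i := (ν i).carrier
  map f := FinalCoalgebra.map _ _ (K.map f)
  map_id i := by rw [K.map_id, FinalCoalgebra.map_id]
  map_comp f g := by rw [K.map_comp, ← FinalCoalgebra.map_comp]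

/-! ### Lifting along `R : D ⟶ C` -/

section Lift

variable {D : Type u₁} [Category.{v₁} D] [CpoCategory D]
  {C : Type u₂} [Category.{v₂} C] [CpoCategory C]

/-- `R` is 2-monic in the 2-category of `Cpo`-categories, `Cpo`-functors and natural
transformations: isomorphisms `R ∘ g ≅ R ∘ h` arise, by applying `R`, from isomorphisms
`g ≅ h`. -/
class TwoMonic (R : CpoFunctor D C) : Prop where
  lift_iso : ∀ (E : Type u₁) [Category.{v₁} E] [CpoCategory E] (g h : CpoFunctor E D)
    (α : g.comp R ≅ h.comp R), ∃ β : g ≅ h, CpoFunctor.whiskerRight β.hom R = α.hom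

/-- The objects of the pseudo-pullback of `R ∘ - : Endo(D) ⟶ [D, C]` and
`- ∘ R : Endo(C) ⟶ [D, C]`. -/
structure LiftPair (R : CpoFunctor D C) where
  H : CpoFunctor D D
  G : CpoFunctor C C
  φ : H.comp R ≅ R.comp G

/-- `R h` and `g R` agree up to the isomorphisms `φ` and `φ'`. -/
def Lifts {R : CpoFunctor D C} {H H' : CpoFunctor D D} {G G' : CpoFunctor C C}
    (φ : H.comp R ≅ R.comp G) (φ' : H'.comp R ≅ R.comp G') (h : H ⟶ H') (g : G ⟶ G') : Prop :=
  CpoFunctor.whiskerRight h R ≫ φ'.hom = φ.hom ≫ CpoFunctor.whiskerLeft R g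

theorem Lifts.id {R : CpoFunctor D C} {H : CpoFunctor D D} {G : CpoFunctor C C}
    (φ : H.comp R ≅ R.comp G) : Lifts φ φ (𝟙 H) (𝟙 G) := by
  simp [Lifts]

theorem Lifts.comp {R : CpoFunctor D C} {H H' H'' : CpoFunctor D D} {G G' G'' : CpoFunctor C C}
    {φ : H.comp R ≅ R.comp G} {φ' : H'.comp R ≅ R.comp G'} {φ'' : H''.comp R ≅ R.comp G''}
    {h : H ⟶ H'} {g : G ⟶ G'} {h' : H' ⟶ H''} {g' : G' ⟶ G''}
    (a : Lifts φ φ' h g) (b : Lifts φ' φ'' h' g') : Lifts φ φ'' (h ≫ h') (g ≫ g') := by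
  unfold Lifts at *
  rw [CpoFunctor.whiskerRight_comp, CpoFunctor.whiskerLeft_comp, Category.assoc, b,
    ← Category.assoc, a, Category.assoc]

/-- The morphisms of the pseudo-pullback. -/
@[ext]
structure LiftPair.Hom {R : CpoFunctor D C} (P Q : LiftPair R) where
  h : P.H ⟶ Q.H
  g : P.G ⟶ Q.G
  w : Lifts P.φ Q.φ h g

/-- The pseudo-pullback of `R ∘ -` and `- ∘ R`. -/
instance (R : CpoFunctor D C) : Category (LiftPair R) where
  Hom := LiftPair.Hom
  id _ := ⟨𝟙 _, 𝟙 _, Lifts.id _⟩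
  comp a b := ⟨a.h ≫ b.h, a.g ≫ b.g, a.w.comp b.w⟩
  id_comp _ := LiftPair.Hom.ext (Category.id_comp _) (Category.id_comp _)
  comp_id _ := LiftPair.Hom.ext (Category.comp_id _) (Category.comp_id _)
  assoc _ _ _ := LiftPair.Hom.ext (Category.assoc _ _ _) (Category.assoc _ _ _)

/-- The first projection of the pseudo-pullback. -/
def LiftPair.p₁ (R : CpoFunctor D C) : LiftPair R ⥤ CpoFunctor D D where
  obj P := P.H
  map a := a.h

/-- The second projection of the pseudo-pullback. -/
def LiftPair.p₂ (R : CpoFunctor D C) : LiftPair R ⥤ CpoFunctor C C where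
  obj P := P.G
  map a := a.g

/-- The objects of `Lift(R)`: the `Cpo`-endofunctors `G` of `C` with `R ∘ H ≅ G ∘ R` for some
`Cpo`-endofunctor `H` of `D`. -/
structure Lifted (R : CpoFunctor D C) where
  obj : CpoFunctor C C
  lifted : ∃ H : CpoFunctor D D, Nonempty (H.comp R ≅ R.comp obj)

/-- The second component of an object of the pseudo-pullback is an object of `Lift(R)`. -/
def LiftPair.toLifted {R : CpoFunctor D C} (P : LiftPair R) : Lifted R := ⟨P.G, P.H, ⟨P.φ⟩⟩

/-- The morphisms of `Lift(R)`: those `g : G ⟶ G'` for which there is `h : H ⟶ H'` in `Endo(D)`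
with `R h ≅ g R`. -/
def IsLiftedHom {R : CpoFunctor D C} (G G' : Lifted R) (g : G.obj ⟶ G'.obj) : Prop :=
  ∃ (H H' : CpoFunctor D D) (φ : H.comp R ≅ R.comp G.obj) (φ' : H'.comp R ≅ R.comp G'.obj)
    (h : H ⟶ H'), Lifts φ φ' h g

/-- The order of `Lift(R)`: `g ≤ g'` in `Endo(C)` and there are `h ≤ h'` in `Endo(D)` with
`R h ≅ g R` and `R h' ≅ g' R`. -/
def LiftedLE {R : CpoFunctor D C} (G G' : Lifted R) (g g' : G.obj ⟶ G'.obj) : Prop :=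
  g ≤ g' ∧ ∃ (H H' : CpoFunctor D D) (φ : H.comp R ≅ R.comp G.obj)
    (φ' : H'.comp R ≅ R.comp G'.obj) (h h' : H ⟶ H'),
    h ≤ h' ∧ Lifts φ φ' h g ∧ Lifts φ φ' h' g'

/-! The discrete parallel pair, used to see that a 2-monic `Cpo`-functor is faithful. -/

abbrev discretePartialOrder (α : Type*) : PartialOrder α where
  le a b := a = b
  le_refl _ := rfl
  le_trans _ _ _ a b := a.trans b
  le_antisymm _ _ a _ := a

abbrev discreteOrder (α : Type*) : OmegaCompletePartialOrder α :=
  { discretePartialOrder α with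
    ωSup := fun c => c 0
    le_ωSup := fun c i => ((letI := discretePartialOrder α; c.monotone (Nat.zero_le i)) :
      c 0 = c i).symm
    ωSup_le := fun _ _ h => h 0 }

attribute [local instance] uliftCategory

abbrev ParPair : Type u₁ := ULiftHom.{v₁} (ULift.{u₁} Limits.WalkingParallelPair)

abbrev ParPair.cpo : CpoCategory ParPair.{v₁, u₁} :=
  CpoCategory.ofOrder (fun X Y => discreteOrder (X ⟶ Y))
    (fun _ _ _ _ (hf : _ = _) (hg : _ = _) => by subst hf hg; exact rfl)
    (fun _ _ _ h => h 0)

attribute [local instance] ParPair.cpo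

/-- A functor out of the discrete parallel pair. -/
def ParPair.functor {X Y : D} (f g : X ⟶ Y) : CpoFunctor ParPair.{v₁, u₁} D where
  toFunctor := ULiftHom.down ⋙ ULift.downFunctor ⋙ Limits.parallelPair f g
  map_cont _ _ := cont_of_le (fun _ _ (h : _ = _) => by rw [h]) (fun _ _ h => h 0)

theorem TwoMonic.faithful (R : CpoFunctor D C) [TwoMonic R] {X Y : D} (f g : X ⟶ Y)
    (h : R.map f = R.map g) : f = g := by
  have key : ∀ (x y : Limits.WalkingParallelPair) (k : x ⟶ y),
      (Limits.parallelPair f f ⋙ R.toFunctor).map k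
        = (Limits.parallelPair f g ⋙ R.toFunctor).map k := by
    rintro x y (_ | _ | _)
    · rfl
    · exact h
    · rfl
  let α : (ParPair.functor.{v₁, u₁} f f).comp R ≅ (ParPair.functor.{v₁, u₁} f g).comp R :=
    { hom :=
        { app := fun _ => 𝟙 _
          naturality := fun a b k => by
            refine (Category.comp_id _).trans (Eq.trans ?_ (Category.id_comp _).symm)
            exact key _ _ k.down }
      inv :=
        { app := fun _ => 𝟙 _
          naturality := fun a b k => by
            refine (Category.comp_id _).trans (Eq.trans ?_ (Category.id_comp _).symm)
            exact (key _ _ k.down).symm }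
      hom_inv_id := CpoFunctor.hom_ext fun _ => Category.id_comp _
      inv_hom_id := CpoFunctor.hom_ext fun _ => Category.id_comp _ }
  obtain ⟨β, -⟩ := TwoMonic.lift_iso (R := R) _ _ _ α
  let z : ParPair.{v₁, u₁} := ULiftHom.up.obj (ULift.up Limits.WalkingParallelPair.zero)
  let o : ParPair.{v₁, u₁} := ULiftHom.up.obj (ULift.up Limits.WalkingParallelPair.one)
  let l : z ⟶ o := ULift.up Limits.WalkingParallelPairHom.left
  let r : z ⟶ o := ULift.up Limits.WalkingParallelPairHom.right
  have h1 : f ≫ CpoFunctor.app β.hom o = CpoFunctor.app β.hom z ≫ f :=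
    CpoFunctor.naturality β.hom l
  have h2 : f ≫ CpoFunctor.app β.hom o = CpoFunctor.app β.hom z ≫ g :=
    CpoFunctor.naturality β.hom r
  have h3 : CpoFunctor.app β.inv z ≫ CpoFunctor.app β.hom z = 𝟙 _ :=
    congrArg (fun γ => CpoFunctor.app γ z) β.inv_hom_id
  have h4 := congrArg (fun k => CpoFunctor.app β.inv z ≫ k) (h1.symm.trans h2)
  have h5 := congrArg (fun k => k ≫ f) h3
  have h6 := congrArg (fun k => k ≫ g) h3
  exact (Category.id_comp f).symm.trans (h5.symm.trans ((Category.assoc _ _ _).trans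
    (h4.trans ((Category.assoc _ _ _).symm.trans (h6.trans (Category.id_comp g))))))

theorem TwoMonic.whiskerRight_inj (R : CpoFunctor D C) [TwoMonic R] {H H' : CpoFunctor D D}
    (h h' : H ⟶ H') (e : CpoFunctor.whiskerRight h R = CpoFunctor.whiskerRight h' R) : h = h' :=
  CpoFunctor.hom_ext fun X => TwoMonic.faithful R _ _
    (congrArg (fun α => CpoFunctor.app α X) e)

section TwoMonicLift

variable {R : CpoFunctor D C}

theorem Lifts.unique [TwoMonic R] {H H' : CpoFunctor D D} {G G' : CpoFunctor C C}
    {φ : H.comp R ≅ R.comp G} {φ' : H'.comp R ≅ R.comp G'} {h h' : H ⟶ H'} {g : G ⟶ G'}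
    (a : Lifts φ φ' h g) (b : Lifts φ φ' h' g) : h = h' := by
  refine TwoMonic.whiskerRight_inj R _ _ ?_
  unfold Lifts at a b
  rw [← cancel_mono φ'.hom, a, b]

/-- Change of witnesses. -/
theorem Lifts.transport [TwoMonic R] {G G' : CpoFunctor C C} {H₁ H₁' H₂ H₂' : CpoFunctor D D}
    (φ₁ : H₁.comp R ≅ R.comp G) (φ₁' : H₁'.comp R ≅ R.comp G')
    (φ₂ : H₂.comp R ≅ R.comp G) (φ₂' : H₂'.comp R ≅ R.comp G') :
    ∃ (β : H₂ ⟶ H₁) (β' : H₁' ⟶ H₂'), ∀ (h : H₁ ⟶ H₁') (g : G ⟶ G'),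
      Lifts φ₁ φ₁' h g → Lifts φ₂ φ₂' (β ≫ h ≫ β') g := by
  obtain ⟨β, hβ⟩ := TwoMonic.lift_iso D H₂ H₁ (φ₂ ≪≫ φ₁.symm)
  obtain ⟨β', hβ'⟩ := TwoMonic.lift_iso D H₁' H₂' (φ₁' ≪≫ φ₂'.symm)
  refine ⟨β.hom, β'.hom, fun h g a => ?_⟩
  unfold Lifts at *
  rw [CpoFunctor.whiskerRight_comp, CpoFunctor.whiskerRight_comp, hβ, hβ']
  simp [reassoc_of% a]

/-- A chosen lifting of an object of `Lift(R)`. -/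
noncomputable def Lifted.H (G : Lifted R) : CpoFunctor D D := G.lifted.choose

noncomputable def Lifted.φ (G : Lifted R) : G.H.comp R ≅ R.comp G.obj :=
  G.lifted.choose_spec.some

/-- An isomorphism of endofunctors of `C` between objects of `Lift(R)` lies in `Lift(R)`. -/
theorem isLiftedHom_of_iso (G G' : Lifted R) (i : G.obj ≅ G'.obj) : IsLiftedHom G G' i.hom := by
  let ψ : R.comp G.obj ≅ R.comp G'.obj :=
    { hom := CpoFunctor.whiskerLeft R i.hom
      inv := CpoFunctor.whiskerLeft R i.inv
      hom_inv_id := by rw [← CpoFunctor.whiskerLeft_comp, i.hom_inv_id]; rfl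
      inv_hom_id := by rw [← CpoFunctor.whiskerLeft_comp, i.inv_hom_id]; rfl }
  refine ⟨G.H, G.H, G.φ, G.φ ≪≫ ψ, 𝟙 _, ?_⟩
  unfold Lifts
  simp [ψ]

theorem IsLiftedHom.exists_lift [TwoMonic R] {G G' : Lifted R} {g : G.obj ⟶ G'.obj}
    (hg : IsLiftedHom G G' g) : ∃ h : G.H ⟶ G'.H, Lifts G.φ G'.φ h g := by
  obtain ⟨H, H', φ, φ', h, a⟩ := hg
  obtain ⟨β, β', t⟩ := Lifts.transport φ φ' G.φ G'.φ
  exact ⟨_, t _ _ a⟩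

theorem LiftedLE.exists_lift [TwoMonic R] {G G' : Lifted R} {g g' : G.obj ⟶ G'.obj}
    (hg : LiftedLE G G' g g') :
    ∃ h h' : G.H ⟶ G'.H, h ≤ h' ∧ Lifts G.φ G'.φ h g ∧ Lifts G.φ G'.φ h' g' := by
  obtain ⟨-, H, H', φ, φ', h, h', l, a, a'⟩ := hg
  obtain ⟨β, β', t⟩ := Lifts.transport φ φ' G.φ G'.φ
  exact ⟨_, _, cpo_comp_mono le_rfl (cpo_comp_mono l le_rfl), t _ _ a, t _ _ a'⟩

/-- The category `Lift(R)`, a subcategory of `Endo(C)`. -/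
instance [TwoMonic R] : Category (Lifted R) where
  Hom G G' := { g : G.obj ⟶ G'.obj // IsLiftedHom G G' g }
  id G := ⟨𝟙 G.obj, G.H, G.H, G.φ, G.φ, 𝟙 _, Lifts.id _⟩
  comp {G G' G''} f g := ⟨f.1 ≫ g.1, by
    obtain ⟨h, a⟩ := f.2.exists_lift
    obtain ⟨k, b⟩ := g.2.exists_lift
    exact ⟨_, _, _, _, _, a.comp b⟩⟩
  id_comp _ := Subtype.ext (Category.id_comp _)
  comp_id _ := Subtype.ext (Category.comp_id _)
  assoc _ _ _ := Subtype.ext (Category.assoc _ _ _)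

variable [TwoMonic R]

/-- The lifting of a morphism of `Lift(R)`. -/
noncomputable def Lifted.lift {G G' : Lifted R} (f : G ⟶ G') : G.H ⟶ G'.H :=
  f.2.exists_lift.choose

theorem Lifted.lift_spec {G G' : Lifted R} (f : G ⟶ G') :
    Lifts G.φ G'.φ (Lifted.lift f) f.1 := f.2.exists_lift.choose_spec

theorem Lifted.lift_comp {G G' G'' : Lifted R} (f : G ⟶ G') (g : G' ⟶ G'') :
    Lifted.lift (f ≫ g) = Lifted.lift f ≫ Lifted.lift g :=
  (Lifted.lift_spec (f ≫ g)).unique ((Lifted.lift_spec f).comp (Lifted.lift_spec g))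

theorem liftedLE_iff {G G' : Lifted R} (f g : G ⟶ G') :
    LiftedLE G G' f.1 g.1 ↔ f.1 ≤ g.1 ∧ Lifted.lift f ≤ Lifted.lift g := by
  constructor
  · intro l
    obtain ⟨h, h', e, a, a'⟩ := l.exists_lift
    rw [(Lifted.lift_spec f).unique a, (Lifted.lift_spec g).unique a']
    exact ⟨l.1, e⟩
  · intro l
    exact ⟨l.1, _, _, _, _, _, _, l.2, Lifted.lift_spec f, Lifted.lift_spec g⟩

/-- The hom-sets of `Lift(R)` are ordered by `LiftedLE`. -/
abbrev liftedPartialOrder (G G' : Lifted R) : PartialOrder (G ⟶ G') where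
  le f g := LiftedLE G G' f.1 g.1
  le_refl f := (liftedLE_iff f f).2 ⟨le_rfl, le_rfl⟩
  le_trans f g k a b := (liftedLE_iff f k).2
    ⟨((liftedLE_iff f g).1 a).1.trans ((liftedLE_iff g k).1 b).1,
      ((liftedLE_iff f g).1 a).2.trans ((liftedLE_iff g k).1 b).2⟩
  le_antisymm _ _ a b := Subtype.ext (a.1.antisymm b.1)

def valChain {G G' : Lifted R} (c : @Chain (G ⟶ G') (liftedPartialOrder G G').toPreorder) :
    Chain (G.obj ⟶ G'.obj) :=
  letI := liftedPartialOrder G G'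
  ⟨⟨fun n => (c n).1, fun _ _ h => (c.monotone h).1⟩⟩

noncomputable def liftChain {G G' : Lifted R}
    (c : @Chain (G ⟶ G') (liftedPartialOrder G G').toPreorder) : Chain (G.H ⟶ G'.H) :=
  letI := liftedPartialOrder G G'
  ⟨⟨fun n => Lifted.lift (c n), fun _ _ h => ((liftedLE_iff _ _).1 (c.monotone h)).2⟩⟩

theorem lifts_sup {G G' : Lifted R}
    (c : @Chain (G ⟶ G') (liftedPartialOrder G G').toPreorder) :
    Lifts G.φ G'.φ (ωSup (liftChain c)) (ωSup (valChain c)) := by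
  refine CpoFunctor.hom_ext fun X => ?_
  have hR := (R.map_cont _ _).map_ωSup (appChain (liftChain c) X)
  let d : Chain (R.obj (G.H.obj X) ⟶ R.obj (G'.H.obj X)) :=
    (appChain (liftChain c) X).map ⟨fun f => R.map f, (R.map_cont _ _).monotone⟩
  let e : Chain (R.obj (G.H.obj X) ⟶ G'.obj.obj (R.obj X)) :=
    d.map ⟨fun f => f ≫ CpoFunctor.app G'.φ.hom X, fun _ _ l => cpo_comp_mono l le_rfl⟩
  have h1 := cpo_comp_eq d (constChain (CpoFunctor.app G'.φ.hom X)) e (fun _ => rfl)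
  have h2 := cpo_comp_eq (constChain (CpoFunctor.app G.φ.hom X))
    (appChain (valChain c) (R.obj X)) e
    (fun i => (congrArg (fun α => CpoFunctor.app α X) (Lifted.lift_spec (c i))).symm)
  change R.map (ωSup (appChain (liftChain c) X)) ≫ CpoFunctor.app G'.φ.hom X
    = CpoFunctor.app G.φ.hom X ≫ ωSup (appChain (valChain c) (R.obj X))
  have h3 := (congrArg (fun k => ωSup d ≫ k)
    (ωSup_constChain (CpoFunctor.app G'.φ.hom X))).symm.trans h1
  have h4 := (congrArg (fun k => k ≫ ωSup (appChain (valChain c) (R.obj X)))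
    (ωSup_constChain (CpoFunctor.app G.φ.hom X))).symm.trans h2
  exact (congrArg (fun k => k ≫ CpoFunctor.app G'.φ.hom X) hR).trans (h3.trans h4.symm)

/-- Suprema of chains in `Lift(R)` are computed in `Endo(C)`. -/
abbrev liftedOrder (G G' : Lifted R) : OmegaCompletePartialOrder (G ⟶ G') :=
  { liftedPartialOrder G G' with
    ωSup := fun c => ⟨ωSup (valChain c), _, _, _, _, _, lifts_sup c⟩
    le_ωSup := fun c i => (liftedLE_iff _ _).2 ⟨le_ωSup (valChain c) i, by
      rw [(Lifted.lift_spec (⟨ωSup (valChain c), _, _, _, _, _, lifts_sup c⟩ : G ⟶ G')).unique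
        (lifts_sup c)]
      exact le_ωSup (liftChain c) i⟩
    ωSup_le := fun c x h => (liftedLE_iff _ _).2
      ⟨ωSup_le (valChain c) x.1 fun i => ((liftedLE_iff _ _).1 (h i)).1, by
        rw [(Lifted.lift_spec (⟨ωSup (valChain c), _, _, _, _, _, lifts_sup c⟩ : G ⟶ G')).unique
          (lifts_sup c)]
        exact ωSup_le (liftChain c) _ fun i => ((liftedLE_iff _ _).1 (h i)).2⟩ }

theorem lift_sup {G G' : Lifted R}
    (c : @Chain (G ⟶ G') (liftedPartialOrder G G').toPreorder) :
    Lifted.lift ((liftedOrder G G').ωSup c) = ωSup (liftChain c) :=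
  (Lifted.lift_spec _).unique (lifts_sup c)

/-- The `Cpo`-category `Lift(R)`. -/
instance : CpoCategory (Lifted R) :=
  CpoCategory.ofOrder liftedOrder
    (fun f f' g g' hf hg => (liftedLE_iff _ _).2 (by
      have h1 := (liftedLE_iff _ _).1 hf
      have h2 := (liftedLE_iff _ _).1 hg
      rw [Lifted.lift_comp, Lifted.lift_comp]
      exact ⟨cpo_comp_mono h1.1 h2.1, cpo_comp_mono h1.2 h2.2⟩))
    (fun c d y h => (liftedLE_iff _ _).2 (by
      rw [Lifted.lift_comp, lift_sup, lift_sup]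
      refine ⟨cpo_comp_sup (valChain c) (valChain d) y.1
        fun i => ((liftedLE_iff _ _).1 (h i)).1, cpo_comp_sup (liftChain c) (liftChain d) _
        fun i => ?_⟩
      have := ((liftedLE_iff _ _).1 (h i)).2
      rw [Lifted.lift_comp] at this
      exact this))

/-- A morphism of the pseudo-pullback gives a morphism of `Lift(R)`. -/
def LiftPair.Hom.toLifted {P Q : LiftPair R} (a : P ⟶ Q) : P.toLifted ⟶ Q.toLifted :=
  ⟨a.g, P.H, Q.H, P.φ, Q.φ, a.h, a.w⟩

end TwoMonicLift

/-- Final invariants lift along `R`: for a chosen assignment `|ν-|` on `Endo(D)` every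
endofunctor in `Lift(R)` has a final coalgebra, and the functors `R ∘ |ν-| ∘ p₁` and
`|ν-| ∘ p₂` from the pseudo-pullback to `C` are isomorphic. -/
def FinalInvariantsLift (R : CpoFunctor D C) (νD : ∀ H : CpoFunctor D D, FinalCoalgebra H) :
    Prop :=
  ∃ νC : ∀ G : Lifted R, FinalCoalgebra G.obj,
    Nonempty (nuFunctor (LiftPair.p₁ R) (fun P => νD P.H) ⋙ R.toFunctor ≅
      nuFunctor (LiftPair.p₂ R) (fun P => νC P.toLifted))

/-! ### The system `G ≅ F(|νH|, |νH|)`, `R ∘ H ≅ G ∘ R` -/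

section System

variable {R : CpoFunctor D C} [TwoMonic R] (νD : ∀ H : CpoFunctor D D, FinalCoalgebra H)
  (F : CpoFunctor (Dᵒᵖ × D) (Lifted R))

/-- `F(|νK|, |νH|)` for `K = Q.H` and `H = P.H`. -/
abbrev Fν (Q P : LiftPair R) : Lifted R :=
  F.obj (Opposite.op (νD Q.H).carrier, (νD P.H).carrier)

/-- `F(|νq|, |νp|) : F(|νQ|, |νP|) ⟶ F(|νQ'|, |νP'|)` for `q : Q' ⟶ Q` and `p : P ⟶ P'`. -/
abbrev FνMap {Q Q' P P' : LiftPair R} (q : Q' ⟶ Q) (p : P ⟶ P') :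
    Fν νD F Q P ⟶ Fν νD F Q' P' :=
  F.map (X := (Opposite.op (νD Q.H).carrier, (νD P.H).carrier))
    (Y := (Opposite.op (νD Q'.H).carrier, (νD P'.H).carrier))
    ((FinalCoalgebra.map (νD Q'.H) (νD Q.H) q.h).op,
      FinalCoalgebra.map (νD P.H) (νD P'.H) p.h)

/-- A solution `(G, H)` of the system, with its witnesses
`φ : R ∘ H ≅ G ∘ R` and `γ : F(|νH|, |νH|) ≅ G`. -/
structure Solution where
  pair : LiftPair R
  γ : Fν νD F pair pair ≅ pair.toLifted

/-- An algebra of the symmetric endofunctor `(Y, X) ↦ (F(|νX|, |νY|), F(|νY|, |νX|))` on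
`Lift(R)ᵒᵖ × Lift(R)` (with objects of `Lift(R)` presented with their liftings): a pair of
morphisms `F(|νY|, |νX|) ⟶ X` and `Y ⟶ F(|νX|, |νY|)`.  Exchanging `X` and `Y` identifies the
coalgebras of this symmetric endofunctor with its algebras, reversing the morphisms. -/
structure SymAlgebra where
  Y : LiftPair R
  X : LiftPair R
  c : Y.toLifted ⟶ Fν νD F X Y
  a : Fν νD F Y X ⟶ X.toLifted

variable {νD F}

/-- A morphism of algebras of the symmetric endofunctor: `p : B.Y ⟶ A.Y` (a morphism
`A.Y ⟶ B.Y` of the dual) and `e : A.X ⟶ B.X`, compatible with the structure maps. -/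
@[ext]
structure SymAlgebra.Hom (A B : SymAlgebra νD F) where
  p : B.Y ⟶ A.Y
  e : A.X ⟶ B.X
  comm_p : B.c ≫ FνMap νD F e p = LiftPair.Hom.toLifted p ≫ A.c
  comm_e : FνMap νD F p e ≫ B.a = A.a ≫ LiftPair.Hom.toLifted e

/-- `A` is an initial algebra of the symmetric endofunctor. -/
def SymAlgebra.IsInitial (A : SymAlgebra νD F) : Prop :=
  ∀ B : SymAlgebra νD F, Nonempty (Unique (SymAlgebra.Hom A B))

/-- The invariant `(G, G)` of the symmetric endofunctor determined by a solution. -/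
def Solution.invariant (S : Solution νD F) : SymAlgebra νD F where
  Y := S.pair
  X := S.pair
  c := S.γ.inv
  a := S.γ.hom

/-- Two solutions are isomorphic: there are mutually inverse isomorphisms `G ≅ G'`, `H ≅ H'`
compatible with `φ`, `φ'` and `γ`, `γ'`. -/
def Solution.Isomorphic (S S' : Solution νD F) : Prop :=
  ∃ m : SymAlgebra.Hom S.invariant S'.invariant, m.e ≫ m.p = 𝟙 S.pair ∧ m.p ≫ m.e = 𝟙 S'.pair

/-- `S` dominates `S'`: the identity of the invariant of `S` factors through the invariant of
`S'`, as `e : S ⟶ S'` followed by `p : S' ⟶ S`, where `(p, e)` is a morphism of algebras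
from the invariant of `S` to that of `S'`, i.e. `(e, p)` is a morphism of coalgebras from the
invariant of `S'` to that of `S`. -/
def Solution.Dominates (S S' : Solution νD F) : Prop :=
  ∃ m : SymAlgebra.Hom S.invariant S'.invariant, m.e ≫ m.p = 𝟙 S.pair

/-- A dominating solution: one that dominates every solution. -/
def Solution.IsDominating (S : Solution νD F) : Prop :=
  ∀ S' : Solution νD F, S.Dominates S'

/-- The idempotent `e ∘ p` on `S'` lies below the identity, in `Endo(D)` and in `Endo(C)`. -/
def IsCoreflection {P P' : LiftPair R} (e : P ⟶ P') (p : P' ⟶ P) : Prop :=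
  e ≫ p = 𝟙 P ∧ (p ≫ e).h ≤ 𝟙 P'.H ∧ (p ≫ e).g ≤ 𝟙 P'.G

end System

end Lift

/-! The endofunctor behind the system factors as `E ∘ N`: here `N = |ν-|` sends an object of the
pseudo-pullback to an object of `D`, and `E` is `F` with chosen liftings. An initial algebra for `N
∘ E` yields one for `E ∘ N` (`existsUnique_rolled`), so the system reduces to a single recursive
equation `A ≅ T(A, A)` in `D`, where `T(Y, X) = |νF(Y, X)|`. For `T` to be a `Cpo`-functor, `|να|`
must depend continuously on `α`. It does, because it is the unique fixed point of an operator
continuous in `α`, and unique fixed points vary continuously even without bottoms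
(`cont_fixedPoint`).

The equation in `D` is solved by eliminating one variable at a time (`exists_isMixedInitial`); a
symmetry argument then makes the two components agree (`exists_diag_isMixedInitial`). Since `R` is
2-monic, morphisms of `Lift(R)` lift uniquely to the pseudo-pullback, so the result can be read in
either.

Once the invariant of `S` is initial, the rest is formal. Swapping `e` and `p` reverses a morphism
between invariants, so a morphism out of `S` followed by its reversal is an endomorphism of an
initial algebra, hence the identity (`Solution.hom_comp_eq_id`). This gives domination and
uniqueness. Over pointed cpos, Scott induction in `D` gives the inequality of a coreflection
(`IsMixedInitial.comp_le_id`), and monotonicity of `F` carries it to solutions. -/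

/-! ### Fixed points of continuous maps -/

section FixedPoints

variable {α β : Type*} [OmegaCompletePartialOrder α] [OmegaCompletePartialOrder β]

/-- Above every post-fixed point of a continuous map there is a fixed point. -/
theorem exists_fixedPoint_ge {f : β → β} (hf : ωScottContinuous f) {x : β} (hx : x ≤ f x) :
    ∃ y, x ≤ y ∧ f y = y := by
  let F : β →𝒄 β := ContinuousHom.ofFun f hf
  exact ⟨ωSup (fixedPoints.iterateChain (F : β →o β) x hx),
    le_ωSup (fixedPoints.iterateChain (F : β →o β) x hx) 0,
    fixedPoints.ωSup_iterate_mem_fixedPoint F x hx⟩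

/-- Induction for the unique fixed point of a continuous map on a pointed cpo. -/
theorem fixedPoint_induction {f : β → β} (hf : ωScottContinuous f) {b : β} (hb : IsBot b)
    {x : β} (hx : ∀ y, f y = y → y = x) {P : β → Prop} (h0 : P b) (hs : ∀ y, P y → P (f y))
    (hsup : ∀ c : Chain β, (∀ n, P (c n)) → P (ωSup c)) : P x := by
  let F : β →𝒄 β := ContinuousHom.ofFun f hf
  -- Uniqueness identifies `x` with the supremum of the iterates of `f` at `b`.
  rw [← hx _ (fixedPoints.ωSup_iterate_mem_fixedPoint F b (hb _))]
  refine hsup _ fun n => ?_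
  change P (f^[n] b)
  induction n with
  | zero => exact h0
  | succ n ih => rw [Function.iterate_succ_apply']; exact hs _ ih

/-- Unique fixed points depend continuously on parameters. -/
theorem cont_fixedPoint {Φ : α × β → β} (hΦ : ωScottContinuous Φ) {φ : α → β}
    (hφ : ∀ a x, Φ (a, x) = x ↔ x = φ a) : ωScottContinuous φ := by
  have hm : Monotone φ := fun a b hab => by
    have hc : ωScottContinuous (fun x => Φ (b, x)) :=
      hΦ.comp (Prod.ωScottContinuous.prodMk ωScottContinuous.const ωScottContinuous.id)
    -- The fixed point at `a` is post-fixed for the operator at `b`, and the fixed point above it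
    -- can only be `φ b`. This replaces iteration from a bottom element, which need not exist.
    have h1 : φ a ≤ Φ (b, φ a) :=
      ((hφ a (φ a)).2 rfl).ge.trans (hΦ.monotone ⟨hab, le_rfl⟩)
    obtain ⟨y, hy, hy'⟩ := exists_fixedPoint_ge hc h1
    exact hy.trans ((hφ b y).1 hy').le
  refine ωScottContinuous.of_monotone_map_ωSup ⟨hm, fun c => ?_⟩
  refine ((hφ _ _).1 ?_).symm
  -- Joint continuity along the chain `(c n, φ (c n))` shows that the supremum of the `φ (c n)` is
  -- fixed by the operator at `ωSup c`.
  have h := hΦ.map_ωSup (c.zip (c.map ⟨φ, hm⟩))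
  rw [Prod.ωSup_zip] at h
  refine h.trans (congrArg ωSup (Chain.ext (funext fun n => ?_)))
  exact (hφ (c n) _).2 rfl

end FixedPoints

/-! ### Continuity of composition, functor actions and evaluation -/

section Continuity

variable {C : Type u} [Category.{v} C] [CpoCategory C] {α : Type*} [OmegaCompletePartialOrder α]

theorem cont_comp {X Y Z : C} {f : α → (X ⟶ Y)} {g : α → (Y ⟶ Z)} (hf : ωScottContinuous f)
    (hg : ωScottContinuous g) : ωScottContinuous (fun a => f a ≫ g a) :=
  (CpoCategory.comp_cont X Y Z).comp (Prod.ωScottContinuous.prodMk hf hg)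

theorem cont_map {D : Type u₁} [Category.{v₁} D] [CpoCategory D] (H : CpoFunctor C D) {X Y : C}
    {f : α → (X ⟶ Y)} (hf : ωScottContinuous f) : ωScottContinuous (fun a => H.map (f a)) :=
  (H.map_cont X Y).comp hf

theorem cont_app {D : Type u₁} [Category.{v₁} D] [CpoCategory D] {G H : CpoFunctor C D} (X : C) :
    ωScottContinuous (fun τ : G ⟶ H => CpoFunctor.app τ X) :=
  cont_of_le (fun _ _ h => h X) (fun c _ h => ωSup_le (appChain c X) _ h)

end Continuity

/-! ### The `Cpo`-functor `|ν-|` -/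

namespace FinalCoalgebra

variable {C : Type u} [Category.{v} C] [CpoCategory C] {H K : CpoFunctor C C}

/-- The structure isomorphism of a final coalgebra. -/
noncomputable def iso (ν : FinalCoalgebra H) : ν.carrier ≅ H.obj ν.carrier :=
  have := Endofunctor.Coalgebra.Terminal.str_isIso ν.final
  asIso ν.coalg.str

/-- Finality in equational form: inverting the structure map turns coalgebra morphisms into fixed
points of an operator on a hom-set. -/
theorem existsUnique_coalgHom (ν : FinalCoalgebra H) {X : C} (c : X ⟶ H.obj X) :
    ∃! x : X ⟶ ν.carrier, x = c ≫ H.map x ≫ ν.iso.inv := by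
  have key : ∀ x : X ⟶ ν.carrier,
      x = c ≫ H.map x ≫ ν.iso.inv ↔ c ≫ H.map x = x ≫ ν.coalg.str := fun x => by
    rw [← Category.assoc, Iso.eq_comp_inv]
    exact eq_comm
  refine ⟨(ν.final.from ⟨X, c⟩).f, (key _).2 (ν.final.from ⟨X, c⟩).h, fun x hx => ?_⟩
  exact congrArg Endofunctor.Coalgebra.Hom.f (ν.final.hom_ext
    (⟨x, (key x).1 hx⟩ : (⟨X, c⟩ : Endofunctor.Coalgebra H.toFunctor) ⟶ ν.coalg) _)

theorem eq_map_iff (νH : FinalCoalgebra H) (νK : FinalCoalgebra K) (α : H ⟶ K)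
    (x : νH.carrier ⟶ νK.carrier) :
    (νH.iso.hom ≫ CpoFunctor.app α νH.carrier) ≫ K.map x ≫ νK.iso.inv = x ↔
      x = map νH νK α := by
  rw [← Category.assoc, Iso.comp_inv_eq]
  refine ⟨map_unique νH νK α x, ?_⟩
  rintro rfl
  exact map_spec νH νK α

/-- The operator characterizing `map νH νK α` is jointly continuous in `α` and the unknown, so
`cont_fixedPoint` applies. -/
theorem cont_map (νH : FinalCoalgebra H) (νK : FinalCoalgebra K) :
    ωScottContinuous (map νH νK) := by
  refine cont_fixedPoint (Φ := fun p : (H ⟶ K) × (νH.carrier ⟶ νK.carrier) =>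
    (νH.iso.hom ≫ CpoFunctor.app p.1 νH.carrier) ≫ K.map p.2 ≫ νK.iso.inv) ?_
    (eq_map_iff νH νK)
  exact cont_comp
    (cont_comp ωScottContinuous.const ((cont_app _).comp Prod.ωScottContinuous_fst))
    (cont_comp (_root_.cont_map K Prod.ωScottContinuous_snd) ωScottContinuous.const)

end FinalCoalgebra

/-- `|ν-|` as a `Cpo`-functor. -/
def nuCpo {D : Type u} [Category.{v} D] [CpoCategory D]
    (νD : ∀ H : CpoFunctor D D, FinalCoalgebra H) : CpoFunctor (CpoFunctor D D) D where
  toFunctor := nuFunctor (𝟭 (CpoFunctor D D)) νD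
  map_cont H K := FinalCoalgebra.cont_map (νD H) (νD K)

/-- In an algebraically compact category the inverse of a final coalgebra is an initial
algebra. -/
theorem FinalCoalgebra.existsUnique_algHom {D : Type u} [Category.{v} D] [CpoCategory D]
    (hD : CpoAlgebraicallyCompact D) {H : CpoFunctor D D} (ν : FinalCoalgebra H) {X : D}
    (a : H.obj X ⟶ X) : ∃! x : ν.carrier ⟶ X, x = ν.iso.hom ≫ H.map x ≫ a := by
  obtain ⟨A, Z, ⟨hA⟩, ⟨hZ⟩, i, hi⟩ := hD H
  let j := hZ.uniqueUpToIso ν.final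
  let k : A.a ≅ ν.carrier := i ≪≫
    ⟨j.hom.f, j.inv.f, congrArg Endofunctor.Coalgebra.Hom.f j.hom_inv_id,
      congrArg Endofunctor.Coalgebra.Hom.f j.inv_hom_id⟩
  -- The canonical isomorphism followed by the comparison of final coalgebras respects the structure
  -- maps, so initiality of `A` transfers along `k`.
  have hk : A.str ≫ k.hom ≫ ν.iso.hom = H.map k.hom := by
    have h : Z.str ≫ H.map j.hom.f = j.hom.f ≫ ν.iso.hom := j.hom.h
    change A.str ≫ (i.hom ≫ j.hom.f) ≫ ν.iso.hom = H.map (i.hom ≫ j.hom.f)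
    rw [H.map_comp, ← hi, Category.assoc, ← h]
    simp only [Category.assoc]
  have := Endofunctor.Algebra.Initial.str_isIso hA
  have key : ∀ x : ν.carrier ⟶ X,
      x = ν.iso.hom ≫ H.map x ≫ a ↔ H.map (k.hom ≫ x) ≫ a = A.str ≫ k.hom ≫ x := fun x => by
    rw [H.map_comp, ← hk]
    simp only [Category.assoc]
    rw [cancel_epi, cancel_epi]
    exact eq_comm
  let t := hA.to ⟨X, a⟩
  refine ⟨k.inv ≫ t.f, (key _).2 ?_, fun x hx => ?_⟩
  · rw [k.hom_inv_id_assoc]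
    exact t.h
  · rw [Iso.eq_inv_comp]
    exact congrArg Endofunctor.Algebra.Hom.f (hA.hom_ext
      (⟨k.hom ≫ x, (key x).1 hx⟩ : A ⟶ (⟨X, a⟩ : Endofunctor.Algebra H.toFunctor)) t)

/-- A choice of final coalgebras. -/
noncomputable def CpoAlgebraicallyCompact.finalCoalgebra {D : Type u} [Category.{v} D]
    [CpoCategory D] (hD : CpoAlgebraicallyCompact D) (H : CpoFunctor D D) : FinalCoalgebra H where
  coalg := (hD H).choose_spec.choose
  final := (hD H).choose_spec.choose_spec.2.1.some

/-! ### Functors of mixed variance -/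

section MixedVariance

variable {D : Type u₁} [Category.{v₁} D] [CpoCategory D]
  {E : Type u₂} [Category.{v₂} E] [CpoCategory E]

/-- The value `T(Y, X)` of a functor of mixed variance. -/
abbrev CpoFunctor.biobj (T : CpoFunctor (Dᵒᵖ × D) E) (Y X : D) : E := T.obj (Opposite.op Y, X)

/-- The action `T(f, g)` of a functor of mixed variance. -/
abbrev CpoFunctor.bimap (T : CpoFunctor (Dᵒᵖ × D) E) {Y Y' X X' : D} (f : Y' ⟶ Y) (g : X ⟶ X') :
    T.biobj Y X ⟶ T.biobj Y' X' :=
  T.map (X := (Opposite.op Y, X)) (Y := (Opposite.op Y', X')) (f.op, g)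

theorem CpoFunctor.bimap_id (T : CpoFunctor (Dᵒᵖ × D) E) (Y X : D) :
    T.bimap (𝟙 Y) (𝟙 X) = 𝟙 (T.biobj Y X) :=
  T.map_id (Opposite.op Y, X)

theorem CpoFunctor.bimap_comp (T : CpoFunctor (Dᵒᵖ × D) E) {Y Y' Y'' X X' X'' : D}
    (f : Y' ⟶ Y) (g : X ⟶ X') (f' : Y'' ⟶ Y') (g' : X' ⟶ X'') :
    T.bimap f g ≫ T.bimap f' g' = T.bimap (f' ≫ f) (g ≫ g') :=
  (T.map_comp (X := (Opposite.op Y, X)) (Y := (Opposite.op Y', X'))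
    (Z := (Opposite.op Y'', X'')) (f.op, g) (f'.op, g')).symm

theorem CpoFunctor.bimap_comp_assoc (T : CpoFunctor (Dᵒᵖ × D) E) {Y Y' Y'' X X' X'' : D} {Z : E}
    (f : Y' ⟶ Y) (g : X ⟶ X') (f' : Y'' ⟶ Y') (g' : X' ⟶ X'') (k : T.biobj Y'' X'' ⟶ Z) :
    T.bimap f g ≫ T.bimap f' g' ≫ k = T.bimap (f' ≫ f) (g ≫ g') ≫ k := by
  rw [← Category.assoc, T.bimap_comp]

theorem CpoFunctor.bimap_mono (T : CpoFunctor (Dᵒᵖ × D) E) {Y Y' X X' : D} {f f' : Y' ⟶ Y}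
    {g g' : X ⟶ X'} (hf : f ≤ f') (hg : g ≤ g') : T.bimap f g ≤ T.bimap f' g' :=
  (T.map_cont (Opposite.op Y, X) (Opposite.op Y', X')).monotone
    (show ((f.op, g) : (Opposite.op Y, X) ⟶ (Opposite.op Y', X')) ≤ (f'.op, g') from ⟨hf, hg⟩)

def opPairChain {Y Y' X X' : D} (c : Chain ((Y' ⟶ Y) × (X ⟶ X'))) :
    Chain ((Opposite.op Y, X) ⟶ (Opposite.op Y', X')) :=
  ⟨⟨fun n => ((c n).1.op, (c n).2), fun _ _ h => ⟨(c.monotone h).1, (c.monotone h).2⟩⟩⟩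

theorem CpoFunctor.cont_bimap (T : CpoFunctor (Dᵒᵖ × D) E) {Y Y' X X' : D} {α : Type*}
    [OmegaCompletePartialOrder α] {f : α → (Y' ⟶ Y)} {g : α → (X ⟶ X')}
    (hf : ωScottContinuous f) (hg : ωScottContinuous g) :
    ωScottContinuous (fun a => T.bimap (f a) (g a)) := by
  have h : ωScottContinuous (fun p : (Y' ⟶ Y) × (X ⟶ X') => T.bimap p.1 p.2) :=
    cont_of_le (fun _ _ h => T.bimap_mono h.1 h.2) fun c y h =>
      le_of_cont (T.map_cont (Opposite.op Y, X) (Opposite.op Y', X')) (opPairChain c) y h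
  exact h.comp (Prod.ωScottContinuous.prodMk hf hg)

/-- The functor `T(Y, -)`. -/
def CpoFunctor.slice (T : CpoFunctor (Dᵒᵖ × D) E) (Y : D) : CpoFunctor D E where
  obj X := T.biobj Y X
  map g := T.bimap (𝟙 Y) g
  map_id X := T.bimap_id Y X
  map_comp f g := by rw [T.bimap_comp, Category.comp_id]
  map_cont _ _ := T.cont_bimap ωScottContinuous.const ωScottContinuous.id

/-- `T(f, -) : T(Y, -) ⟶ T(Y', -)` for `f : Y' ⟶ Y`. -/
def CpoFunctor.sliceMap (T : CpoFunctor (Dᵒᵖ × D) E) {Y Y' : D} (f : Y' ⟶ Y) :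
    T.slice Y ⟶ T.slice Y' where
  app X := T.bimap f (𝟙 X)
  naturality X X' g := by
    change T.bimap (𝟙 Y) g ≫ T.bimap f (𝟙 X') = T.bimap f (𝟙 X) ≫ T.bimap (𝟙 Y') g
    simp only [T.bimap_comp, Category.comp_id, Category.id_comp]

end MixedVariance

/-! ### Mixed variance in a compact category: one variable as a parameter -/

section Compact

variable {D : Type u} [Category.{v} D] [CpoCategory D]
  (νD : ∀ H : CpoFunctor D D, FinalCoalgebra H) (T : CpoFunctor (Dᵒᵖ × D) D)

/-- The carrier of the final coalgebra of `T(Y, -)`. -/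
abbrev nuSlice (Y : D) : D := (νD (T.slice Y)).carrier

/-- `|νT(Y, -)|` is contravariant in `Y`. -/
def nuSliceMap {Y Y' : D} (f : Y' ⟶ Y) : nuSlice νD T Y ⟶ nuSlice νD T Y' :=
  (νD _).map (νD _) (T.sliceMap f)

noncomputable def nuSliceIso (Y : D) : nuSlice νD T Y ≅ T.biobj Y (nuSlice νD T Y) :=
  (νD (T.slice Y)).iso

/-- Merging the actions of `f` and `x` into one `T(f, x)` presents `nuSliceMap` as the unique
solution of a mixed equation. -/
theorem eq_nuSliceMap_iff {Y Y' : D} (f : Y' ⟶ Y) (x : nuSlice νD T Y ⟶ nuSlice νD T Y') :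
    x = (nuSliceIso νD T Y).hom ≫ T.bimap f x ≫ (nuSliceIso νD T Y').inv ↔
      x = nuSliceMap νD T f := by
  rw [nuSliceMap, ← FinalCoalgebra.eq_map_iff, eq_comm, Category.assoc]
  change _ ↔ (nuSliceIso νD T Y).hom ≫ T.bimap f (𝟙 _) ≫ T.bimap (𝟙 Y') x ≫
    (nuSliceIso νD T Y').inv = x
  rw [← Category.assoc (T.bimap f (𝟙 _)), T.bimap_comp, Category.id_comp, Category.id_comp]

theorem nuSliceMap_spec {Y Y' : D} (f : Y' ⟶ Y) :
    nuSliceMap νD T f = (nuSliceIso νD T Y).hom ≫ T.bimap f (nuSliceMap νD T f) ≫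
      (nuSliceIso νD T Y').inv :=
  (eq_nuSliceMap_iff νD T f _).2 rfl

theorem nuSliceMap_id (Y : D) : nuSliceMap νD T (𝟙 Y) = 𝟙 _ :=
  ((eq_nuSliceMap_iff νD T _ _).1 (by rw [T.bimap_id]; simp)).symm

theorem nuSliceMap_comp {Y Y' Y'' : D} (f : Y' ⟶ Y) (g : Y'' ⟶ Y') :
    nuSliceMap νD T f ≫ nuSliceMap νD T g = nuSliceMap νD T (g ≫ f) := by
  refine (eq_nuSliceMap_iff νD T _ _).1 ?_
  rw [← T.bimap_comp]
  conv_lhs => rw [nuSliceMap_spec νD T f, nuSliceMap_spec νD T g]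
  simp

theorem cont_sliceMap {Y Y' : D} : ωScottContinuous (fun f : Y' ⟶ Y => T.sliceMap f) :=
  cont_of_le (fun _ _ h _ => T.bimap_mono h le_rfl) fun c _ h X =>
    le_of_cont (f := fun f => T.bimap f (𝟙 X))
      (T.cont_bimap ωScottContinuous.id ωScottContinuous.const) c _ fun i => h i X

theorem cont_nuSliceMap {Y Y' : D} : ωScottContinuous (fun f : Y' ⟶ Y => nuSliceMap νD T f) :=
  (FinalCoalgebra.cont_map (νD (T.slice Y)) (νD (T.slice Y'))).comp (cont_sliceMap T)

/-- The covariant functor `Y ↦ T(|νT(Y, -)|, Y)`. -/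
def diagNu : CpoFunctor D D where
  obj Y := T.biobj (nuSlice νD T Y) Y
  map f := T.bimap (nuSliceMap νD T f) f
  map_id Y := by rw [nuSliceMap_id, T.bimap_id]
  map_comp f g := by rw [T.bimap_comp, nuSliceMap_comp]
  map_cont _ _ := T.cont_bimap (cont_nuSliceMap νD T) ωScottContinuous.id

/-- Elimination of `e` for given `p`. The equation makes `e` an algebra morphism from the inverse of
the final `T(Y', -)`-coalgebra to `X` with structure `T(p, X)` followed by `a`. By compactness there
is only one. -/
theorem eq_nuSliceMap_comp_iff (hD : CpoAlgebraicallyCompact D) {Y Y' X : D}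
    (a : T.biobj Y X ⟶ X) {e' : nuSlice νD T Y ⟶ X}
    (he' : e' = (nuSliceIso νD T Y).hom ≫ T.bimap (𝟙 Y) e' ≫ a) (p : Y ⟶ Y')
    (e : nuSlice νD T Y' ⟶ X) :
    e = (nuSliceIso νD T Y').hom ≫ T.bimap p e ≫ a ↔ e = nuSliceMap νD T p ≫ e' := by
  obtain ⟨e₀, -, h₀⟩ := (νD (T.slice Y')).existsUnique_algHom hD (X := X)
    (T.bimap p (𝟙 X) ≫ a)
  have key : ∀ e : nuSlice νD T Y' ⟶ X, e = (nuSliceIso νD T Y').hom ≫ T.bimap p e ≫ a →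
      e = e₀ := fun e he => h₀ e (by
    change e = (nuSliceIso νD T Y').hom ≫ T.bimap (𝟙 Y') e ≫ T.bimap p (𝟙 X) ≫ a
    rw [T.bimap_comp_assoc, Category.comp_id, Category.comp_id]
    exact he)
  have h : nuSliceMap νD T p ≫ e' =
      (nuSliceIso νD T Y').hom ≫ T.bimap p (nuSliceMap νD T p ≫ e') ≫ a := by
    conv_lhs => rw [nuSliceMap_spec νD T p, he']
    have := T.bimap_comp p (nuSliceMap νD T p) (𝟙 Y) e'
    rw [Category.id_comp] at this
    simp [← this]
  exact ⟨fun he => (key e he).trans (key _ h).symm, fun he => he ▸ h⟩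

/-- The dual elimination of `p` for given `e`; finality alone gives uniqueness. -/
theorem eq_comp_nuSliceMap_iff {Y Y' X : D}
    (c : X ⟶ T.biobj Y X) {p' : X ⟶ nuSlice νD T Y}
    (hp' : p' = c ≫ T.bimap (𝟙 Y) p' ≫ (nuSliceIso νD T Y).inv) (e : Y' ⟶ Y)
    (p : X ⟶ nuSlice νD T Y') :
    p = c ≫ T.bimap e p ≫ (nuSliceIso νD T Y').inv ↔ p = p' ≫ nuSliceMap νD T e := by
  obtain ⟨p₀, -, h₀⟩ := (νD (T.slice Y')).existsUnique_coalgHom (X := X)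
    (c ≫ T.bimap e (𝟙 X))
  have key : ∀ p : X ⟶ nuSlice νD T Y', p = c ≫ T.bimap e p ≫ (nuSliceIso νD T Y').inv →
      p = p₀ := fun p hp => h₀ p (by
    change p = (c ≫ T.bimap e (𝟙 X)) ≫ T.bimap (𝟙 Y') p ≫ (nuSliceIso νD T Y').inv
    rw [Category.assoc, T.bimap_comp_assoc, Category.id_comp,
      Category.id_comp]
    exact hp)
  have h : p' ≫ nuSliceMap νD T e =
      c ≫ T.bimap e (p' ≫ nuSliceMap νD T e) ≫ (nuSliceIso νD T Y').inv := by
    conv_lhs => rw [nuSliceMap_spec νD T e, hp']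
    have := T.bimap_comp (𝟙 Y) p' e (nuSliceMap νD T e)
    rw [Category.comp_id] at this
    simp [← this]
  exact ⟨fun hp => (key p hp).trans (key _ h).symm, fun hp => hp ▸ h⟩

/-! ### Initial algebras of the symmetric endofunctor on `Dᵒᵖ × D` -/

variable {T} in
/-- The pair `(Y, X)`, with `y : Y ≅ T(X, Y)` and `x : X ≅ T(Y, X)`, is an initial algebra of
the symmetric endofunctor `(Y, X) ↦ (T(X, Y), T(Y, X))` of `Dᵒᵖ × D`. -/
def IsMixedInitial {Y₀ X₀ : D} (y : Y₀ ≅ T.biobj X₀ Y₀) (x : X₀ ≅ T.biobj Y₀ X₀) : Prop :=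
  ∀ (Y X : D) (c : Y ⟶ T.biobj X Y) (a : T.biobj Y X ⟶ X),
    ∃! q : (Y ⟶ Y₀) × (X₀ ⟶ X),
      q.1 = c ≫ T.bimap q.2 q.1 ≫ y.inv ∧ q.2 = x.hom ≫ T.bimap q.1 q.2 ≫ a

/-- The initial algebra of the symmetric endofunctor of `Dᵒᵖ × D`, computed one variable at a
time; its inverse is a final coalgebra. -/
theorem exists_isMixedInitial (hD : CpoAlgebraicallyCompact D) :
    ∃ (Y₀ X₀ : D) (y : Y₀ ≅ T.biobj X₀ Y₀) (x : X₀ ≅ T.biobj Y₀ X₀),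
      IsMixedInitial y x ∧ IsMixedInitial x y := by
  let νD := hD.finalCoalgebra
  -- Substituting the parametrized solution `X = |νT(Y, -)|` into `Y ≅ T(X, Y)` leaves a covariant
  -- equation in `Y` alone.
  let N := νD (diagNu νD T)
  let z : N.carrier ≅ T.biobj (nuSlice νD T N.carrier) N.carrier := N.iso
  refine ⟨N.carrier, nuSlice νD T N.carrier, z, nuSliceIso νD T _, ?_, ?_⟩
  · intro Y X c a
    obtain ⟨e', he', -⟩ : ∃! e' : nuSlice νD T Y ⟶ X,
      e' = (nuSliceIso νD T Y).hom ≫ T.bimap (𝟙 Y) e' ≫ a :=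
        (νD (T.slice Y)).existsUnique_algHom hD a
    -- With `e` eliminated, `p` only has to be a coalgebra morphism into `N`.
    obtain ⟨p, hp, hp'⟩ : ∃! p : Y ⟶ N.carrier, p = (c ≫ T.bimap e' (𝟙 Y)) ≫
      T.bimap (nuSliceMap νD T p) p ≫ z.inv := N.existsUnique_coalgHom (X := Y) _
    have comp : ∀ p : Y ⟶ N.carrier, (c ≫ T.bimap e' (𝟙 Y)) ≫ T.bimap (nuSliceMap νD T p) p ≫
        z.inv = c ≫ T.bimap (nuSliceMap νD T p ≫ e') p ≫ z.inv := fun p => by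
      rw [Category.assoc, T.bimap_comp_assoc, Category.id_comp]
    refine ⟨(p, nuSliceMap νD T p ≫ e'), ⟨?_, ?_⟩, ?_⟩
    · exact hp.trans (comp p)
    · exact (eq_nuSliceMap_comp_iff νD T hD a he' p _).2 rfl
    · rintro ⟨p₁, e₁⟩ ⟨h1, h2⟩
      have h3 := (eq_nuSliceMap_comp_iff νD T hD a he' p₁ _).1 h2
      dsimp only at h1 h3
      subst h3
      obtain rfl := hp' p₁ (h1.trans (comp p₁).symm)
      rfl
  · intro Y X c a
    obtain ⟨p', hp', -⟩ : ∃! p' : Y ⟶ nuSlice νD T X,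
      p' = c ≫ T.bimap (𝟙 X) p' ≫ (nuSliceIso νD T X).inv :=
        (νD (T.slice X)).existsUnique_coalgHom c
    -- In the exchanged order `p` is eliminated, and `e` is an algebra morphism out of the inverse
    -- of `N`, initial by compactness.
    obtain ⟨e, he, he'⟩ : ∃! e : N.carrier ⟶ X, e = z.hom ≫
      T.bimap (nuSliceMap νD T e) e ≫ T.bimap p' (𝟙 X) ≫ a := N.existsUnique_algHom hD (X := X) _
    have comp : ∀ e : N.carrier ⟶ X, z.hom ≫ T.bimap (nuSliceMap νD T e) e ≫
        T.bimap p' (𝟙 X) ≫ a = z.hom ≫ T.bimap (p' ≫ nuSliceMap νD T e) e ≫ a := fun e => by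
      rw [T.bimap_comp_assoc, Category.comp_id]
    refine ⟨(p' ≫ nuSliceMap νD T e, e), ⟨?_, ?_⟩, ?_⟩
    · exact (eq_comp_nuSliceMap_iff νD T c hp' e _).2 rfl
    · exact he.trans (comp e)
    · rintro ⟨p₁, e₁⟩ ⟨h1, h2⟩
      have h3 := (eq_comp_nuSliceMap_iff νD T c hp' e₁ _).1 h1
      dsimp only at h2 h3
      subst h3
      obtain rfl := he' e₁ (h2.trans (comp e₁).symm)
      rfl

variable {T} in
theorem IsMixedInitial.ext {Y₀ X₀ : D} {y : Y₀ ≅ T.biobj X₀ Y₀} {x : X₀ ≅ T.biobj Y₀ X₀}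
    (h : IsMixedInitial y x) {Y X : D} (c : Y ⟶ T.biobj X Y) (a : T.biobj Y X ⟶ X)
    {p p' : Y ⟶ Y₀} {e e' : X₀ ⟶ X}
    (h1 : p = c ≫ T.bimap e p ≫ y.inv) (h2 : e = x.hom ≫ T.bimap p e ≫ a)
    (h1' : p' = c ≫ T.bimap e' p' ≫ y.inv) (h2' : e' = x.hom ≫ T.bimap p' e' ≫ a) :
    p = p' ∧ e = e' :=
  Prod.ext_iff.1 ((h Y X c a).unique (y₁ := (p, e)) (y₂ := (p', e')) ⟨h1, h2⟩ ⟨h1', h2'⟩)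

variable {T} in
/-- The comparison of a mixed initial algebra with the algebra obtained by exchanging its
components is the same in both components. -/
theorem IsMixedInitial.exists_swap {Y₀ X₀ : D} {y : Y₀ ≅ T.biobj X₀ Y₀}
    {x : X₀ ≅ T.biobj Y₀ X₀} (h : IsMixedInitial y x) :
    ∃ s : X₀ ⟶ Y₀, s = x.hom ≫ T.bimap s s ≫ y.inv := by
  obtain ⟨⟨p, e⟩, ⟨h1, h2⟩, -⟩ := h X₀ Y₀ x.hom y.inv
  dsimp only at h1 h2
  -- Swapping `p` and `e` exchanges the two equations, so `(e, p)` is a solution too.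
  obtain ⟨rfl, -⟩ := h.ext _ _ h1 h2 h2 h1
  exact ⟨p, h1⟩

/-- The diagonal form of the initial algebra: an isomorphism `A ≅ T(A, A)`. -/
theorem exists_diag_isMixedInitial (hD : CpoAlgebraicallyCompact D) :
    ∃ (A : D) (i : A ≅ T.biobj A A), IsMixedInitial i i := by
  obtain ⟨Y₀, X₀, y, x, h, h'⟩ := exists_isMixedInitial T hD
  obtain ⟨s, hs⟩ := h.exists_swap
  obtain ⟨t, ht⟩ := h'.exists_swap
  -- Both `(t ≫ s, s ≫ t)` and the pair of identities are endomorphisms of the same initial algebra.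
  have endo : ∀ {B B' : D} {b : B ≅ T.biobj B' B} {b' : B' ≅ T.biobj B B'}
      (_ : IsMixedInitial b b') (s : B' ⟶ B) (t : B ⟶ B'), s = b'.hom ≫ T.bimap s s ≫ b.inv →
      t = b.hom ≫ T.bimap t t ≫ b'.inv → t ≫ s = 𝟙 B ∧ s ≫ t = 𝟙 B' := by
    intro B B' b b' hb s t hs ht
    refine hb.ext b.hom b'.inv ?_ ?_ ?_ ?_
    · rw [← T.bimap_comp]
      conv_lhs => rw [hs, ht]
      simp
    · rw [← T.bimap_comp]
      conv_lhs => rw [hs, ht]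
      simp
    · rw [T.bimap_id]; simp
    · rw [T.bimap_id]; simp
  obtain ⟨hts, hst⟩ := endo h s t hs ht
  have hid : ∀ {P Q : D}, T.bimap (𝟙 P) (𝟙 Q) = 𝟙 _ := T.bimap_id _ _
  let i : X₀ ≅ T.biobj X₀ X₀ :=
    { hom := x.hom ≫ T.bimap s (𝟙 X₀)
      inv := T.bimap t (𝟙 X₀) ≫ x.inv
      hom_inv_id := by
        rw [Category.assoc, T.bimap_comp_assoc, hts,
          Category.comp_id, hid]
        simp
      inv_hom_id := by
        rw [Category.assoc, x.inv_hom_id_assoc, T.bimap_comp, hst, Category.comp_id, hid] }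
  -- Built from `x`, the isomorphism `i` is also `y` transported along `s` and `t`, so it can serve
  -- as both structure maps.
  have hinv : i.inv = T.bimap (𝟙 X₀) s ≫ y.inv ≫ t := by
    rw [ht]
    change T.bimap t (𝟙 X₀) ≫ x.inv = _
    rw [y.inv_hom_id_assoc, ← Category.assoc, T.bimap_comp, hst, Category.comp_id]
  refine ⟨X₀, i, fun Y X c a => ?_⟩
  -- Solutions for `i` and for `(y, x)` correspond by composing `p` with the isomorphism `s`.
  have trans : ∀ (p : Y ⟶ X₀) (e : X₀ ⟶ X),
      (p = c ≫ T.bimap e p ≫ i.inv ∧ e = i.hom ≫ T.bimap p e ≫ a) ↔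
      (p ≫ s = c ≫ T.bimap e (p ≫ s) ≫ y.inv ∧
        e = x.hom ≫ T.bimap (p ≫ s) e ≫ a) := by
    intro p e
    have h1 : T.bimap e p ≫ i.inv = T.bimap e (p ≫ s) ≫ y.inv ≫ t := by
      rw [hinv, ← Category.assoc, T.bimap_comp, Category.id_comp]
    have h2 : i.hom ≫ T.bimap p e = x.hom ≫ T.bimap (p ≫ s) e := by
      change (x.hom ≫ T.bimap s (𝟙 X₀)) ≫ _ = _
      rw [Category.assoc, T.bimap_comp, Category.id_comp]
    rw [h1, ← Category.assoc i.hom, h2, Category.assoc]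
    refine and_congr_left fun _ => ⟨fun hp => ?_, fun hp => ?_⟩
    · conv_lhs => rw [hp]
      simp [hts]
    · have := congrArg (· ≫ t) hp
      simpa [hst] using this
  obtain ⟨⟨p, e⟩, hpe, hu⟩ := h Y X c a
  refine ⟨(p ≫ t, e), (trans _ _).2 ?_, ?_⟩
  · simpa [hts] using hpe
  · rintro ⟨p₁, e₁⟩ hq
    have h3 := hu (p₁ ≫ s, e₁) ((trans _ _).1 hq)
    rw [Prod.mk.injEq] at h3
    rw [Prod.mk.injEq, ← h3.1, Category.assoc, hst, Category.comp_id]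
    exact ⟨rfl, h3.2⟩

variable {T} in
/-- Over pointed cpos, the morphisms between the initial algebra and any other fixed point
satisfy `e ∘ p ≤ id`. -/
theorem IsMixedInitial.comp_le_id (hB : IsCpoBotEnriched D) {A : D} {i : A ≅ T.biobj A A}
    (h : IsMixedInitial i i) {X : D} (c : X ⟶ T.biobj X X) (a : T.biobj X X ⟶ X)
    (hca : c ≫ a = 𝟙 X) {p : X ⟶ A} {e : A ⟶ X} (hp : p = c ≫ T.bimap e p ≫ i.inv)
    (he : e = i.hom ≫ T.bimap p e ≫ a) : p ≫ e ≤ 𝟙 X := by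
  obtain ⟨b, hb⟩ := hB.1 X A
  obtain ⟨b', hb'⟩ := hB.1 A X
  -- Scott induction for the operator whose unique fixed point is `(p, e)`. The base case uses that
  -- a composite of least morphisms is least.
  refine fixedPoint_induction (β := (X ⟶ A) × (A ⟶ X)) (b := (b, b')) (x := (p, e))
    (f := fun q => (c ≫ T.bimap q.2 q.1 ≫ i.inv, i.hom ≫ T.bimap q.1 q.2 ≫ a))
    (P := fun q => q.1 ≫ q.2 ≤ 𝟙 X) ?_ (fun q => show _ ∧ _ from ⟨hb _, hb' _⟩) ?_ ?_ ?_ ?_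
  · exact Prod.ωScottContinuous.prodMk
      (cont_comp ωScottContinuous.const (cont_comp
        (T.cont_bimap Prod.ωScottContinuous_snd Prod.ωScottContinuous_fst) ωScottContinuous.const))
      (cont_comp ωScottContinuous.const (cont_comp
        (T.cont_bimap Prod.ωScottContinuous_fst Prod.ωScottContinuous_snd) ωScottContinuous.const))
  · rintro ⟨p', e'⟩ hq
    rw [Prod.mk.injEq] at hq
    exact Prod.ext_iff.2 (h.ext c a hq.1.symm hq.2.symm hp he)
  · exact hB.2 _ _ _ _ _ hb hb' _
  · rintro ⟨p', e'⟩ (hq : p' ≫ e' ≤ 𝟙 X)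
    -- The two occurrences of `i` cancel, so the new composite is monotone in `p' ≫ e'` and bounded
    -- by its value `c ≫ a` at the identity.
    have h1 : (c ≫ T.bimap e' p' ≫ i.inv) ≫ i.hom ≫ T.bimap p' e' ≫ a =
        c ≫ T.bimap (p' ≫ e') (p' ≫ e') ≫ a := by
      rw [← T.bimap_comp]; simp
    have h2 : c ≫ T.bimap (𝟙 X) (𝟙 X) ≫ a = 𝟙 X := by
      rw [T.bimap_id, Category.id_comp, hca]
    exact h1.le.trans ((cpo_comp_mono le_rfl (cpo_comp_mono (T.bimap_mono hq hq) le_rfl)).trans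
      h2.le)
  · exact fun ch hch => cpo_comp_sup (ch.map OrderHom.fst) (ch.map OrderHom.snd) _ hch

end Compact

/-! ### Transferring initial algebras along a factorization -/

section Rolling

variable {D : Type u₁} [Category.{v₁} D] {L : Type u₂} [Category.{v₂} L]

/-- The action `E(f, g)` of a functor of mixed variance. -/
abbrev mixedMap (E : Dᵒᵖ × D ⥤ L) {Y Y' X X' : D} (f : Y' ⟶ Y) (g : X ⟶ X') :
    E.obj (Opposite.op Y, X) ⟶ E.obj (Opposite.op Y', X') :=
  E.map (X := (Opposite.op Y, X)) (Y := (Opposite.op Y', X')) (f.op, g)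

theorem mixedMap_id (E : Dᵒᵖ × D ⥤ L) (Y X : D) :
    mixedMap E (𝟙 Y) (𝟙 X) = 𝟙 (E.obj (Opposite.op Y, X)) :=
  E.map_id (Opposite.op Y, X)

theorem mixedMap_comp (E : Dᵒᵖ × D ⥤ L) {Y Y' Y'' X X' X'' : D} (f : Y' ⟶ Y) (g : X ⟶ X')
    (f' : Y'' ⟶ Y') (g' : X' ⟶ X'') :
    mixedMap E f g ≫ mixedMap E f' g' = mixedMap E (f' ≫ f) (g ≫ g') :=
  (E.map_comp (X := (Opposite.op Y, X)) (Y := (Opposite.op Y', X'))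
    (Z := (Opposite.op Y'', X'')) (f.op, g) (f'.op, g')).symm

theorem mixedMap_comp_assoc (E : Dᵒᵖ × D ⥤ L) {Y Y' Y'' X X' X'' : D} {Z : L} (f : Y' ⟶ Y)
    (g : X ⟶ X') (f' : Y'' ⟶ Y') (g' : X' ⟶ X'') (k : E.obj (Opposite.op Y'', X'') ⟶ Z) :
    mixedMap E f g ≫ mixedMap E f' g' ≫ k = mixedMap E (f' ≫ f) (g ≫ g') ≫ k := by
  rw [← Category.assoc, mixedMap_comp]

/-- A mixed functor acts on isomorphisms. -/
def mixedIso (E : Dᵒᵖ × D ⥤ L) {A B : D} (i : A ≅ B) :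
    E.obj (Opposite.op B, B) ≅ E.obj (Opposite.op A, A) where
  hom := mixedMap E i.hom i.inv
  inv := mixedMap E i.inv i.hom
  hom_inv_id := by rw [mixedMap_comp, i.inv_hom_id, mixedMap_id]
  inv_hom_id := by rw [mixedMap_comp, i.hom_inv_id, mixedMap_id]

variable (N : L ⥤ D) (E : Dᵒᵖ × D ⥤ L) {A : D} (i : A ≅ N.obj (E.obj (Opposite.op A, A)))

/-- Moving the structure isomorphism across shows that `(p, e)` is determined by `N.map p ≫ i.inv`
and `i.hom ≫ N.map e`, the corresponding morphisms in `D`. -/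
theorem rolled_comm_iff {Y X : L} (c : Y ⟶ E.obj (Opposite.op (N.obj X), N.obj Y))
    (a : E.obj (Opposite.op (N.obj Y), N.obj X) ⟶ X) (p : Y ⟶ E.obj (Opposite.op A, A))
    (e : E.obj (Opposite.op A, A) ⟶ X) :
    (c ≫ mixedMap E (N.map e) (N.map p) = p ≫ (mixedIso E i).inv ∧
      mixedMap E (N.map p) (N.map e) ≫ a = (mixedIso E i).hom ≫ e) ↔
    (p = c ≫ mixedMap E (i.hom ≫ N.map e) (N.map p ≫ i.inv) ∧
      e = mixedMap E (N.map p ≫ i.inv) (i.hom ≫ N.map e) ≫ a) := by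
  rw [Iso.eq_comp_inv, ← Iso.inv_comp_eq]
  change ((c ≫ mixedMap E _ _) ≫ mixedMap E i.hom i.inv = p ∧
    mixedMap E i.inv i.hom ≫ mixedMap E _ _ ≫ a = e) ↔ _
  rw [Category.assoc, mixedMap_comp, mixedMap_comp_assoc]
  exact and_congr eq_comm eq_comm

/-- If `A` is initial for the mixed functor `N ∘ E`, then `E(A, A)` is initial for `E ∘ N`. -/
theorem existsUnique_rolled
    (h : ∀ (Y X : D) (c : Y ⟶ N.obj (E.obj (Opposite.op X, Y)))
      (a : N.obj (E.obj (Opposite.op Y, X)) ⟶ X), ∃! q : (Y ⟶ A) × (A ⟶ X),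
        q.1 = c ≫ N.map (mixedMap E q.2 q.1) ≫ i.inv ∧
          q.2 = i.hom ≫ N.map (mixedMap E q.1 q.2) ≫ a)
    {Y X : L} (c : Y ⟶ E.obj (Opposite.op (N.obj X), N.obj Y))
    (a : E.obj (Opposite.op (N.obj Y), N.obj X) ⟶ X) :
    ∃! q : (Y ⟶ E.obj (Opposite.op A, A)) × (E.obj (Opposite.op A, A) ⟶ X),
      c ≫ mixedMap E (N.map q.2) (N.map q.1) = q.1 ≫ (mixedIso E i).inv ∧
        mixedMap E (N.map q.1) (N.map q.2) ≫ a = (mixedIso E i).hom ≫ q.2 := by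
  obtain ⟨⟨p, e⟩, ⟨hp, he⟩, hu⟩ := h (N.obj Y) (N.obj X) (N.map c) (N.map a)
  dsimp only at hp he
  rw [← Category.assoc, ← N.map_comp] at hp
  rw [← N.map_comp] at he
  -- One application of `E` carries the solution in `D` to `L`; applying `N` and correcting by `i`
  -- recovers it.
  refine ⟨(c ≫ mixedMap E e p, mixedMap E p e ≫ a),
    (rolled_comm_iff N E i c a _ _).2 ⟨?_, ?_⟩, ?_⟩
  · dsimp only; rw [← hp, ← he]
  · dsimp only; rw [← hp, ← he]
  · rintro ⟨p', e'⟩ hq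
    obtain ⟨h1, h2⟩ := (rolled_comm_iff N E i c a p' e').1 hq
    -- Any other solution also yields one in `D`, where uniqueness applies.
    have h3 := hu (N.map p' ≫ i.inv, i.hom ≫ N.map e') ⟨by
      dsimp only
      rw [← Category.assoc (N.map c), ← N.map_comp, ← h1], by
      dsimp only
      rw [← N.map_comp, ← h2]⟩
    rw [Prod.mk.injEq] at h3
    rw [h3.1, h3.2] at h1 h2
    rw [h1, h2]

/-- A morphism `(e, p)` from `E(A, A)` to another fixed point of `E ∘ N` comes from a morphism
`(e', p')` of fixed points of `N ∘ E`, which determines the endomorphism `e ∘ p`. -/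
theorem rolled_idempotent {X : L} (γ : E.obj (Opposite.op (N.obj X), N.obj X) ≅ X)
    (p : X ⟶ E.obj (Opposite.op A, A)) (e : E.obj (Opposite.op A, A) ⟶ X)
    (hp : γ.inv ≫ mixedMap E (N.map e) (N.map p) = p ≫ (mixedIso E i).inv)
    (he : mixedMap E (N.map p) (N.map e) ≫ γ.hom = (mixedIso E i).hom ≫ e) :
    ∃ (p' : N.obj X ⟶ A) (e' : A ⟶ N.obj X),
      p' = N.map γ.inv ≫ N.map (mixedMap E e' p') ≫ i.inv ∧
      e' = i.hom ≫ N.map (mixedMap E p' e') ≫ N.map γ.hom ∧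
      p ≫ e = γ.inv ≫ mixedMap E (p' ≫ e') (p' ≫ e') ≫ γ.hom := by
  obtain ⟨h1, h2⟩ := (rolled_comm_iff N E i γ.inv γ.hom p e).1 ⟨hp, he⟩
  refine ⟨N.map p ≫ i.inv, i.hom ≫ N.map e, ?_, ?_, ?_⟩
  · rw [← Category.assoc (N.map γ.inv), ← N.map_comp, ← h1]
  · rw [← N.map_comp, ← h2]
  · exact (congrArg₂ (· ≫ ·) h1 h2).trans (by
      rw [Category.assoc, mixedMap_comp_assoc])

end Rolling

/-! ### Between `Lift(R)` and the pseudo-pullback -/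

section Lift

variable {D : Type u₁} [Category.{v₁} D] [CpoCategory D]
  {C : Type u₂} [Category.{v₂} C] [CpoCategory C] {R : CpoFunctor D C} [TwoMonic R]

/-- The pseudo-pullback is equivalent to `Lift(R)`: its projection is faithful. -/
theorem LiftPair.hom_ext {P Q : LiftPair R} {a b : P ⟶ Q} (h : a.g = b.g) : a = b :=
  LiftPair.Hom.ext (Lifts.unique (h ▸ a.w) b.w) h

theorem LiftPair.toLifted_injective {P Q : LiftPair R} {a b : P ⟶ Q}
    (h : LiftPair.Hom.toLifted a = LiftPair.Hom.toLifted b) : a = b :=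
  LiftPair.hom_ext (congrArg Subtype.val h)

theorem LiftPair.toLifted_comp {P Q S : LiftPair R} (a : P ⟶ Q) (b : Q ⟶ S) :
    LiftPair.Hom.toLifted (a ≫ b) = LiftPair.Hom.toLifted a ≫ LiftPair.Hom.toLifted b := rfl

/-- The liftings witnessing `f` need not be those of `P` and `Q`; 2-monicity transports between
them. -/
theorem LiftPair.exists_hom {P Q : LiftPair R} (f : P.toLifted ⟶ Q.toLifted) :
    ∃ a : P ⟶ Q, LiftPair.Hom.toLifted a = f := by
  obtain ⟨f, H, H', φ, φ', h, w⟩ := f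
  obtain ⟨β, β', t⟩ := Lifts.transport φ φ' P.φ Q.φ
  exact ⟨⟨_, f, t _ _ w⟩, rfl⟩

theorem LiftPair.exists_iso {P Q : LiftPair R} (f : P.toLifted ≅ Q.toLifted) :
    ∃ a : P ≅ Q, LiftPair.Hom.toLifted a.hom = f.hom ∧ LiftPair.Hom.toLifted a.inv = f.inv := by
  obtain ⟨a, ha⟩ := LiftPair.exists_hom f.hom
  obtain ⟨b, hb⟩ := LiftPair.exists_hom f.inv
  refine ⟨⟨a, b, LiftPair.toLifted_injective ?_, LiftPair.toLifted_injective ?_⟩, ha, hb⟩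
  · rw [LiftPair.toLifted_comp, ha, hb, f.hom_inv_id]; rfl
  · rw [LiftPair.toLifted_comp, ha, hb, f.inv_hom_id]; rfl

variable (R) in
/-- The chosen liftings of the objects of `Lift(R)`. -/
noncomputable def liftedToPair : Lifted R ⥤ LiftPair R where
  obj G := ⟨G.H, G.obj, G.φ⟩
  map f := ⟨Lifted.lift f, f.1, Lifted.lift_spec f⟩
  map_id _ := LiftPair.hom_ext rfl
  map_comp _ _ := LiftPair.hom_ext rfl

variable (R) in
/-- The lifting of morphisms of `Lift(R)` to `Endo(D)`. -/
noncomputable def liftCpo : CpoFunctor (Lifted R) (CpoFunctor D D) where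
  toFunctor := liftedToPair R ⋙ LiftPair.p₁ R
  map_cont _ _ := ωScottContinuous.of_monotone_map_ωSup
    ⟨fun _ _ h => ((liftedLE_iff _ _).1 h).2, fun c => lift_sup c⟩

/-! ### The mixed functor `|νF|` on `D` and the solutions it yields -/

variable (νD : ∀ H : CpoFunctor D D, FinalCoalgebra H) (F : CpoFunctor (Dᵒᵖ × D) (Lifted R))

/-- `|ν-|` on the pseudo-pullback. -/
abbrev nuPair : LiftPair R ⥤ D := nuFunctor (LiftPair.p₁ R) (fun P => νD P.H)

/-- The functor `(Y, X) ↦ |νF(Y, X)|` of mixed variance on `D`. -/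
noncomputable def nuBi : CpoFunctor (Dᵒᵖ × D) D := (F.comp (liftCpo R)).comp (nuCpo νD)

/-- `F` with its chosen liftings. -/
noncomputable abbrev pairBi : Dᵒᵖ × D ⥤ LiftPair R := F.toFunctor ⋙ liftedToPair R

variable {νD F}

/-- The solution given by a fixed point of `(Y, X) ↦ |νF(Y, X)|`. -/
noncomputable def solutionOfFixedPoint {A : D} (i : A ≅ (nuBi νD F).biobj A A) :
    Solution νD F where
  pair := (pairBi F).obj (Opposite.op A, A)
  γ := mixedIso F.toFunctor i

/-- Faithfulness lets the equations be checked in the pseudo-pullback, where the transfer applies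
with `N = nuPair νD` and `E = pairBi F`. -/
theorem hom_comm_iff {A : D} {i : A ≅ (nuBi νD F).biobj A A} {Y X : LiftPair R}
    (c : Y ⟶ (pairBi F).obj (Opposite.op ((nuPair νD).obj X), (nuPair νD).obj Y))
    (a : (pairBi F).obj (Opposite.op ((nuPair νD).obj Y), (nuPair νD).obj X) ⟶ X)
    (p : Y ⟶ (solutionOfFixedPoint i).pair) (e : (solutionOfFixedPoint i).pair ⟶ X) :
    (LiftPair.Hom.toLifted c ≫ FνMap νD F e p =
        LiftPair.Hom.toLifted p ≫ (solutionOfFixedPoint i).γ.inv ∧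
      FνMap νD F p e ≫ LiftPair.Hom.toLifted a =
        (solutionOfFixedPoint i).γ.hom ≫ LiftPair.Hom.toLifted e) ↔
    (c ≫ mixedMap (pairBi F) ((nuPair νD).map e) ((nuPair νD).map p) =
        p ≫ (mixedIso (pairBi F) i).inv ∧
      mixedMap (pairBi F) ((nuPair νD).map p) ((nuPair νD).map e) ≫ a =
        (mixedIso (pairBi F) i).hom ≫ e) :=
  and_congr
    ⟨fun h => LiftPair.toLifted_injective h, fun h => congrArg LiftPair.Hom.toLifted h⟩
    ⟨fun h => LiftPair.toLifted_injective h, fun h => congrArg LiftPair.Hom.toLifted h⟩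

theorem isInitial_solutionOfFixedPoint {A : D} {i : A ≅ (nuBi νD F).biobj A A}
    (h : IsMixedInitial i i) : (solutionOfFixedPoint i).invariant.IsInitial := by
  rintro ⟨Y, X, c, a⟩
  obtain ⟨c, rfl⟩ := LiftPair.exists_hom (P := Y)
    (Q := (pairBi F).obj (Opposite.op ((nuPair νD).obj X), (nuPair νD).obj Y)) c
  obtain ⟨a, rfl⟩ := LiftPair.exists_hom
    (P := (pairBi F).obj (Opposite.op ((nuPair νD).obj Y), (nuPair νD).obj X)) (Q := X) a
  -- `h` has the required form because `nuBi νD F` unfolds to `pairBi F` followed by `nuPair νD`.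
  obtain ⟨⟨p, e⟩, hpe, hu⟩ := existsUnique_rolled (nuPair νD) (pairBi F) i h c a
  have hm := (hom_comm_iff c a p e).2 hpe
  refine ⟨⟨⟨⟨p, e, hm.1, hm.2⟩⟩, fun m => ?_⟩⟩
  have h3 := hu (m.p, m.e) ((hom_comm_iff c a m.p m.e).1 ⟨m.comm_p, m.comm_e⟩)
  exact SymAlgebra.Hom.ext (congrArg Prod.fst h3) (congrArg Prod.snd h3)

/-! ### Composition and reversal of morphisms; domination and coreflections -/

theorem FνMap_comp {Q Q' Q'' P P' P'' : LiftPair R} (q : Q' ⟶ Q) (p : P ⟶ P') (q' : Q'' ⟶ Q')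
    (p' : P' ⟶ P'') :
    FνMap νD F q p ≫ FνMap νD F q' p' = FνMap νD F (q' ≫ q) (p ≫ p') :=
  (mixedMap_comp F.toFunctor _ _ _ _).trans
    (congrArg₂ (mixedMap F.toFunctor) ((nuPair νD).map_comp q' q).symm
      ((nuPair νD).map_comp p p').symm)

theorem FνMap_id (Q P : LiftPair R) : FνMap νD F (𝟙 Q) (𝟙 P) = 𝟙 (Fν νD F Q P) :=
  (congrArg₂ (mixedMap F.toFunctor) ((nuPair νD).map_id Q) ((nuPair νD).map_id P)).trans
    (mixedMap_id F.toFunctor _ _)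

/-- Exchanging the two components of a morphism between invariants reverses its direction. -/
def SymAlgebra.Hom.swap {S S' : Solution νD F} (m : SymAlgebra.Hom S.invariant S'.invariant) :
    SymAlgebra.Hom S'.invariant S.invariant where
  p := m.e
  e := m.p
  comm_p := (Iso.inv_comp_eq S.γ).2 (((Iso.eq_comp_inv S'.γ).2 m.comm_e).trans
    (Category.assoc _ _ _))
  comm_e := ((Iso.inv_comp_eq S'.γ).1 ((Iso.eq_comp_inv S.γ).1 m.comm_p |>.symm.trans
    (Category.assoc _ _ _) |>.symm))

def SymAlgebra.Hom.id (A : SymAlgebra νD F) : SymAlgebra.Hom A A where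
  p := 𝟙 A.Y
  e := 𝟙 A.X
  comm_p := by rw [FνMap_id, Category.comp_id]; exact (Category.id_comp _).symm
  comm_e := by rw [FνMap_id, Category.id_comp]; exact (Category.comp_id _).symm

def SymAlgebra.Hom.comp {A B B' : SymAlgebra νD F} (m : SymAlgebra.Hom A B)
    (n : SymAlgebra.Hom B B') : SymAlgebra.Hom A B' where
  p := n.p ≫ m.p
  e := m.e ≫ n.e
  comm_p := by
    rw [← FνMap_comp, ← Category.assoc, n.comm_p, Category.assoc, m.comm_p,
      LiftPair.toLifted_comp, Category.assoc]
  comm_e := by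
    rw [← FνMap_comp, Category.assoc, n.comm_e, ← Category.assoc, m.comm_e,
      LiftPair.toLifted_comp, Category.assoc]

/-- Followed by its reversal, `m` is an endomorphism of an initial algebra. -/
theorem Solution.hom_comp_eq_id {S : Solution νD F} (hS : S.invariant.IsInitial)
    {S' : Solution νD F} (m : SymAlgebra.Hom S.invariant S'.invariant) :
    (m.comp m.swap).e = 𝟙 S.pair := by
  obtain ⟨u⟩ := hS S.invariant
  have h := (u.uniq (m.comp m.swap)).trans (u.uniq (SymAlgebra.Hom.id _)).symm
  exact congrArg SymAlgebra.Hom.e h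

theorem Solution.isDominating_of_isInitial {S : Solution νD F} (hS : S.invariant.IsInitial) :
    S.IsDominating := fun S' => by
  obtain ⟨u⟩ := hS S'.invariant
  exact ⟨u.default, Solution.hom_comp_eq_id hS _⟩

/-- That `S'` dominates `S` makes one composite the identity; initiality of `S` settles the other.
-/
theorem Solution.isomorphic_of_isDominating {S : Solution νD F} (hS : S.invariant.IsInitial)
    {S' : Solution νD F} (hS' : S'.IsDominating) : S.Isomorphic S' := by
  obtain ⟨m, hm⟩ := hS' S
  exact ⟨m.swap, Solution.hom_comp_eq_id hS m.swap, hm⟩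

/-- The order of `Lift(R)` compares transformations together with their liftings, so monotonicity of
`F` gives both bounds at once. -/
theorem pairBi_le_id (F : CpoFunctor (Dᵒᵖ × D) (Lifted R)) {X : D} {f : X ⟶ X} (hf : f ≤ 𝟙 X) :
    (mixedMap (pairBi F) f f).h ≤ 𝟙 _ ∧ (mixedMap (pairBi F) f f).g ≤ 𝟙 _ := by
  have h := (liftedLE_iff _ _).1 (F.bimap_mono hf hf)
  have hid := mixedMap_id (pairBi F) X X
  exact ⟨h.2.trans (congrArg LiftPair.Hom.h hid).le, h.1.trans (congrArg LiftPair.Hom.g hid).le⟩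

/-- By `rolled_idempotent`, the endomorphism of `S'` is, up to conjugation by `γ`, the value of `F`
at an endomorphism in `D`, which `IsMixedInitial.comp_le_id` places below the identity. -/
theorem isCoreflection_solutionOfFixedPoint (hB : IsCpoBotEnriched D) {A : D}
    {i : A ≅ (nuBi νD F).biobj A A} (h : IsMixedInitial i i) {S' : Solution νD F}
    (m : SymAlgebra.Hom (solutionOfFixedPoint i).invariant S'.invariant) :
    IsCoreflection m.e m.p := by
  refine ⟨Solution.hom_comp_eq_id (isInitial_solutionOfFixedPoint h) m, ?_⟩
  let X := (nuPair νD).obj S'.pair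
  obtain ⟨γ, ha, hc⟩ := LiftPair.exists_iso (P := (pairBi F).obj (Opposite.op X, X))
    (Q := S'.pair) S'.γ
  obtain ⟨h1, h2⟩ := (hom_comm_iff (i := i) γ.inv γ.hom m.p m.e).1
    ⟨(congrArg (· ≫ FνMap νD F m.e m.p) hc).trans m.comm_p,
      (congrArg (FνMap νD F m.p m.e ≫ ·) ha).trans m.comm_e⟩
  obtain ⟨p, e, hp, he, hq⟩ := rolled_idempotent (nuPair νD) (pairBi F) i γ m.p m.e h1 h2
  have hle : p ≫ e ≤ 𝟙 X := h.comp_le_id hB _ _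
    (((nuPair νD).map_comp γ.inv γ.hom).symm.trans
      ((congrArg (nuPair νD).map γ.inv_hom_id).trans ((nuPair νD).map_id _))) hp he
  obtain ⟨l1, l2⟩ := pairBi_le_id F hle
  have hid : γ.inv ≫ 𝟙 _ ≫ γ.hom = 𝟙 S'.pair := by simp
  constructor
  · exact (congrArg LiftPair.Hom.h hq).le.trans
      ((cpo_comp_mono le_rfl (cpo_comp_mono l1 le_rfl)).trans (congrArg LiftPair.Hom.h hid).le)
  · exact (congrArg LiftPair.Hom.g hq).le.trans
      ((cpo_comp_mono le_rfl (cpo_comp_mono l2 le_rfl)).trans (congrArg LiftPair.Hom.g hid).le)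

end Lift

theorem mainTheorem3 {D : Type u₁} [Category.{v₁} D] [CpoCategory D]
    {C : Type u₂} [Category.{v₂} C] [CpoCategory C]
    (hD : CpoAlgebraicallyCompact D)
    (νD : ∀ H : CpoFunctor D D, FinalCoalgebra H)
    (R : CpoFunctor D C) [TwoMonic R] (hR : FinalInvariantsLift R νD)
    (F : CpoFunctor (Dᵒᵖ × D) (Lifted R)) :
    ∃ S : Solution νD F,
      S.IsDominating ∧
      (∀ S' : Solution νD F, S'.IsDominating → S.Isomorphic S') ∧
      S.invariant.IsInitial ∧
      (IsCpoBotEnriched D → ∀ (S' : Solution νD F)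
        (m : SymAlgebra.Hom S.invariant S'.invariant), IsCoreflection m.e m.p) := by
  obtain ⟨A, i, h⟩ := exists_diag_isMixedInitial (nuBi νD F) hD
  have hS := isInitial_solutionOfFixedPoint h
  exact ⟨solutionOfFixedPoint i, Solution.isDominating_of_isInitial hS,
    fun _ => Solution.isomorphic_of_isDominating hS, hS,
    fun hB _ m => isCoreflection_solutionOfFixedPoint hB h m⟩
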